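/- Let $\kappa$ be an uncountable regular cardinal with $2^{<\kappa}=\kappa$. All spaces are regular Hausdorff topological spaces. The $\kappa$-Borel subsets of a space are the members of the smallest family of subsets that contains the open sets and is closed under complements and under unions of at most $\kappa$ members; a $\kappa$-Borel isomorphism is a bijection $f$ such that preimages of $\kappa$-Borel sets under both $f$ and $f^{-1}$ are $\kappa$-Borel. A space is $\kappa$-additive if intersections of fewer than $\kappa$ open sets are open. In the strong $\kappa$-Choquet game on $X$, at round $\alpha<\kappa$ player I plays a set $U_\alpha\subseteq\bigcap_{\beta<\alpha}V_\beta$, open relatively to $\bigcap_{\beta<\alpha}V_\beta$ (which is $X$ if $\alpha=0$), and a point $x_\alpha\in U_\alpha$; player II answers with a set $V_\alpha$, also open relatively to $\bigcap_{\beta<\alpha}V_\beta$, with $x_\alpha\in V_\alpha\subseteq U_\alpha$. Player II wins if $\bigcap_{\alpha<\gamma}V_\alpha\neq\emptyset$ for every limit $\gamma\le\kappa$ (so I wins if the intersection is empty at a limit $\gamma<\kappa$). In the strong fair $\kappa$-Choquet game, II wins if either $\bigcap_{\alpha<\gamma}V_\alpha=\emptyset$ for some limit $\gamma<\kappa$,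 or $\bigcap_{\alpha<\kappa}V_\alpha\neq\emptyset$. An $\mathrm{SC}_\kappa$-space (respectively, $f\mathrm{SC}_\kappa$-space) is a space of weight $\le\kappa$ on which player II has a winning strategy in the strong (respectively, strong fair) $\kappa$-Choquet game. Let $\mathbb{G}$ be a totally ordered Abelian group of degree $\kappa$, i.e. such that the coinitiality of $\mathbb{G}^+=\{\varepsilon\in\mathbb{G}:\varepsilon>0\}$ is $\kappa$. A $\mathbb{G}$-metric on $X$ is a map $d:X^2\to\mathbb{G}^+\cup\{0\}$ satisfying the usual axioms of a metric; it is compatible if its open balls (with radii in $\mathbb{G}^+$) generate the topology of $X$, and Cauchy-complete if all Cauchy sequences of length $\kappa$ converge. A space is $\mathbb{G}$-Polish if it has weight $\le\kappa$ and a compatible Cauchy-complete $\mathbb{G}$-metric, and spherically complete $\mathbb{G}$-Polish if it has weight $\le\kappa$ and a compatible Cauchy-complete $\mathbb{G}$-metric for which every decreasing (with respect to inclusion) sequence of open balls, of any nonzero ordinal length, has nonempty intersection. (The empty space is counted in all of these classes.) Then the following classes of spaces are the same up to $\kappa$-Borel isomorphism, that is, each space in one of the classes is $\kappa$-Borel isomorphic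 to some space in each of the others: 1. $f\mathrm{SC}_\kappa$-spaces; 2. $\mathrm{SC}_\kappa$-spaces; 3. $\mathbb{G}$-Polish spaces (for any totally ordered Abelian group $\mathbb{G}$ of degree $\kappa$); 4. $\kappa$-additive $\mathrm{SC}_\kappa$-spaces. Moreover, for every such $\mathbb{G}$, a space is a $\kappa$-additive $\mathrm{SC}_\kappa$-space if and only if it is a spherically complete $\mathbb{G}$-Polish space. -/

import Mathlib

open Cardinal Ordinal Set

universe u

namespace GenPolish

/-! ### Weight, additivity, and the `κ`-Borel structure -/

/-- The space `X` has weight at most `κ`: its topology has a basis of cardinality `≤ κ`. -/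
def WeightLE (κ : Cardinal.{u}) (X : Type u) [TopologicalSpace X] : Prop :=
  ∃ B : Set (Set X), TopologicalSpace.IsTopologicalBasis B ∧ #B ≤ κ

/-- The topology of `X` is closed under intersections of fewer than `κ` open sets. -/
def IsAdditive (κ : Cardinal.{u}) (X : Type u) [TopologicalSpace X] : Prop :=
  ∀ S : Set (Set X), #S < κ → (∀ U ∈ S, IsOpen U) → IsOpen (⋂₀ S)

/-- `A` is a `κ⁺`-algebra of subsets of `X`: it is closed under complements and under unions of
fewer than `κ⁺` of its members (the empty union included, so that `∅` and `X` belong to `A`). -/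
def IsSuccAlgebra (κ : Cardinal.{u}) {X : Type u} (A : Set (Set X)) : Prop :=
  (∀ B ∈ A, Bᶜ ∈ A) ∧ ∀ S ⊆ A, #S < Order.succ κ → ⋃₀ S ∈ A

/-- The `κ`-Borel subsets of `X`: the smallest `κ⁺`-algebra containing the open sets. -/
def Bor (κ : Cardinal.{u}) (X : Type u) [TopologicalSpace X] : Set (Set X) :=
  {B | ∀ A : Set (Set X), IsSuccAlgebra κ A → (∀ U, IsOpen U → U ∈ A) → B ∈ A}

/-- The topological spaces `X` and `Y` are `κ`-Borel isomorphic: there is a bijection between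
them such that preimages of `κ`-Borel sets are `κ`-Borel in both directions. -/
def KBorelIso (κ : Cardinal.{u}) (X Y : Type u) [TopologicalSpace X] [TopologicalSpace Y] : Prop :=
  ∃ f : X ≃ Y, (∀ B ∈ Bor κ Y, f ⁻¹' B ∈ Bor κ X) ∧ ∀ B ∈ Bor κ X, f.symm ⁻¹' B ∈ Bor κ Y

/-- A class of topological spaces. -/
abbrev SpaceClass : Type (u + 1) := ∀ (X : Type u) [TopologicalSpace X], Prop

/-- Two classes of spaces are the same up to `κ`-Borel isomorphism: every space in either class
is `κ`-Borel isomorphic to some space in the other class. -/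
def SameUpToKBorelIso (κ : Cardinal.{u}) (C D : SpaceClass.{u}) : Prop :=
  (∀ (X : Type u) [TopologicalSpace X], C X →
    ∃ (Y : Type u) (_ : TopologicalSpace Y), D Y ∧ KBorelIso κ X Y) ∧
  (∀ (Y : Type u) [TopologicalSpace Y], D Y →
    ∃ (X : Type u) (_ : TopologicalSpace X), C X ∧ KBorelIso κ X Y)

/-! ### The strong `κ`-Choquet game and its fair version

At round `α` player I plays a pair `(U α, x α)` and player II answers with `V α`.
A play of player I is a function on all ordinals, of which only the values below the length
of the run matter. -/

section Game

variable {X : Type u}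

/-- A strategy for player II: it gives his move at round `α` from the moves `(U β, x β)`,
`β ≤ α`, made by player I so far. -/
def Strategy (X : Type u) : Type (u + 1) :=
  (α : Ordinal.{u}) → (Set.Iic α → Set X × X) → Set X

/-- The move `V α` of player II following `σ` against the play `p` of player I. -/
def Strategy.reply (σ : Strategy X) (p : Ordinal.{u} → Set X × X) (α : Ordinal.{u}) : Set X :=
  σ α (fun β => p β)

/-- What is left before round `α`: the intersection of all `V β` with `β < α`. -/
def Strategy.stage (σ : Strategy X) (p : Ordinal.{u} → Set X × X) (α : Ordinal.{u}) : Set X :=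
  ⋂ β < α, σ.reply p β

/-- `U` is a subset of `S`, open relatively to `S`. -/
def RelOpen [TopologicalSpace X] (S U : Set X) : Prop :=
  ∃ O : Set X, IsOpen O ∧ U = S ∩ O

/-- Player I's move `(U α, x α)` is legal: `U α` is relatively open in what is left, `x α ∈ U α`. -/
def Strategy.LegalI [TopologicalSpace X] (σ : Strategy X) (p : Ordinal.{u} → Set X × X)
    (α : Ordinal.{u}) : Prop :=
  RelOpen (σ.stage p α) (p α).1 ∧ (p α).2 ∈ (p α).1

/-- Player II's move `V α` is legal: `V α` is relatively open in what was left before the round,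
and `x α ∈ V α ⊆ U α`. -/
def Strategy.LegalII [TopologicalSpace X] (σ : Strategy X) (p : Ordinal.{u} → Set X × X)
    (α : Ordinal.{u}) : Prop :=
  RelOpen (σ.stage p α) (σ.reply p α) ∧ (p α).2 ∈ σ.reply p α ∧ σ.reply p α ⊆ (p α).1

/-- `σ` is winning for player II in the strong `κ`-Choquet game: in every run of length
`γ ≤ κ` in which I obeys the rules and II follows `σ`, player II obeys the rules, and if `γ` is
a limit then the intersection of the moves is nonempty. -/
def Strategy.IsWinning [TopologicalSpace X] (κ : Cardinal.{u}) (σ : Strategy X) : Prop :=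
  ∀ (p : Ordinal.{u} → Set X × X) (γ : Ordinal.{u}), γ ≤ κ.ord → (∀ α < γ, σ.LegalI p α) →
    (∀ α < γ, σ.LegalII p α) ∧ (Order.IsSuccLimit γ → (σ.stage p γ).Nonempty)

/-- `σ` is winning for player II in the strong fair `κ`-Choquet game: in every run of length
`γ ≤ κ` in which I obeys the rules and II follows `σ`, player II obeys the rules, and if `γ = κ`
then the intersection of the moves is nonempty. A run whose intersection is empty at
a limit `γ < κ` cannot be continued by I, and is won by II. -/
def Strategy.IsFairWinning [TopologicalSpace X] (κ : Cardinal.{u}) (σ : Strategy X) : Prop :=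
  ∀ (p : Ordinal.{u} → Set X × X) (γ : Ordinal.{u}), γ ≤ κ.ord → (∀ α < γ, σ.LegalI p α) →
    (∀ α < γ, σ.LegalII p α) ∧ (γ = κ.ord → (σ.stage p γ).Nonempty)

end Game

/-- `SC_κ`-spaces: regular Hausdorff spaces of weight `≤ κ` such that player II has a winning
strategy in the strong `κ`-Choquet game. -/
def IsSC (κ : Cardinal.{u}) (X : Type u) [TopologicalSpace X] : Prop :=
  T3Space X ∧ WeightLE κ X ∧ ∃ σ : Strategy X, σ.IsWinning κ

/-- `fSC_κ`-spaces: regular Hausdorff spaces of weight `≤ κ` such that player II has a winning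
strategy in the strong fair `κ`-Choquet game. -/
def IsFSC (κ : Cardinal.{u}) (X : Type u) [TopologicalSpace X] : Prop :=
  T3Space X ∧ WeightLE κ X ∧ ∃ σ : Strategy X, σ.IsFairWinning κ

/-- `κ`-additive `SC_κ`-spaces. -/
def IsAdditiveSC (κ : Cardinal.{u}) (X : Type u) [TopologicalSpace X] : Prop :=
  IsAdditive κ X ∧ IsSC κ X

/-! ### Metrics with values in a totally ordered abelian group -/

section Metric

/-- The degree of an ordered group: the coinitiality of its positive cone. -/
noncomputable def degree (G : Type u) [AddCommGroup G] [LinearOrder G] : Cardinal.{u} :=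
  Order.cof ({g : G // 0 < g}ᵒᵈ)

/-- A `G`-metric on `X`. -/
structure GMetric (G : Type u) [AddCommGroup G] [LinearOrder G] (X : Type u) where
  /-- The distance function. -/
  dist : X → X → G
  dist_nonneg : ∀ x y, 0 ≤ dist x y
  dist_eq_zero_iff : ∀ x y, dist x y = 0 ↔ x = y
  dist_comm : ∀ x y, dist x y = dist y x
  dist_triangle : ∀ x y z, dist x z ≤ dist x y + dist y z

variable {G : Type u} [AddCommGroup G] [LinearOrder G] {X : Type u}

/-- The open ball with centre `x` and radius `ε`. -/
def GMetric.ball (d : GMetric G X) (x : X) (ε : G) : Set X := {y | d.dist x y < ε}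

/-- The topology of `X` is the one generated by the open balls of `d`. -/
def GMetric.Compatible [t : TopologicalSpace X] (d : GMetric G X) : Prop :=
  t = TopologicalSpace.generateFrom {B | ∃ (x : X) (ε : G), 0 < ε ∧ B = d.ball x ε}

/-- Every Cauchy sequence of length `κ` converges. -/
def GMetric.CauchyComplete (κ : Cardinal.{u}) (d : GMetric G X) : Prop :=
  ∀ x : Set.Iio κ.ord → X,
    (∀ ε : G, 0 < ε → ∃ α, ∀ β γ, α ≤ β → α ≤ γ → d.dist (x β) (x γ) < ε) →
    ∃ y : X, ∀ ε : G, 0 < ε → ∃ α, ∀ β, α ≤ β → d.dist (x β) y < ε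

/-- Every decreasing sequence of open balls, of any ordinal length, has nonempty intersection. -/
def GMetric.SphericallyComplete (d : GMetric G X) : Prop :=
  ∀ (l : Ordinal.{u}), 0 < l → ∀ (x : Set.Iio l → X) (r : Set.Iio l → G), (∀ i, 0 < r i) →
    (∀ i j, i ≤ j → d.ball (x j) (r j) ⊆ d.ball (x i) (r i)) →
    (⋂ i, d.ball (x i) (r i)).Nonempty

end Metric

/-- `G`-Polish spaces: spaces of weight `≤ κ` with a compatible Cauchy-complete `G`-metric. -/
def IsGPolish (κ : Cardinal.{u}) (G : Type u) [AddCommGroup G] [LinearOrder G]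
    (X : Type u) [TopologicalSpace X] : Prop :=
  T3Space X ∧ WeightLE κ X ∧ ∃ d : GMetric G X, d.Compatible ∧ d.CauchyComplete κ

/-- Spherically complete `G`-Polish spaces: spaces of weight `≤ κ` with a compatible `G`-metric
that is both Cauchy-complete and spherically complete. -/
def IsSphericallyCompleteGPolish (κ : Cardinal.{u}) (G : Type u) [AddCommGroup G] [LinearOrder G]
    (X : Type u) [TopologicalSpace X] : Prop :=
  T3Space X ∧ WeightLE κ X ∧
    ∃ d : GMetric G X, d.Compatible ∧ d.CauchyComplete κ ∧ d.SphericallyComplete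

end GenPolish

/-!
All the classes lie between the `κ`-additive `SC_κ`-spaces and the `fSC_κ`-spaces. In a `G`-Polish
space player II wins the fair game by shrinking diameters (`IsGPolish.isFSC`), and the other
inclusions are clear once the spherically complete `G`-Polish spaces are identified with the
`κ`-additive `SC_κ`-spaces. So two things have to be shown: that identification, and that every
`fSC_κ`-space is `κ`-Borel isomorphic to some `κ`-additive `SC_κ`-space.

Both come from one construction. Given a strategy `σ` of player II on a regular space of weight
`≤ κ`, a tree of `κ` many successive partitions of the space is built together with a run of the
game at each node (`node`, `TreeData.step_succeeds`). At round `α`, player I plays near each point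
of the given cell, a small subfamily of the answers of player II still covers the cell, and it is
made disjoint along a well-order of type `≤ κ`. The new cells are the old cell cut by an answer of
player II and by a closed set. A sequence of pairs `P α ⊆ Q α` of closed and open sets decides
where player I plays: inside `Q α` if his point is in `P α`, and off `P α` otherwise. This makes
the cells shrink to points. It also makes up for the closed sets, which player I cannot force in
one move: a point left in the intersection of a run of length `κ` but outside one of these closed
sets would be in some later `P α` and so would have been excluded. Hence each branch of length `κ`
of the tree is the branch of a point as soon as `σ` wins the fair game
(`TreeData.exists_mem_of_fair`).

If the space is `κ`-additive, then it is zero-dimensional, the cells can be taken clopen, and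
player I can play inside them. If `σ` wins the strong game, then the branches of all lengths have
nonempty intersection (`TreeData.exists_mem_of_additive`). The tree defines an ultrametric with
values in a coinitial sequence of `G`, and this ultrametric is spherically complete
(`IsAdditiveSC.isSphericallyCompleteGPolish`). Conversely, player II wins the strong game by
playing balls of a spherically complete metric
(`IsSphericallyCompleteGPolish.isAdditiveSC`).

For an `fSC_κ`-space there may be branches that end at a level below `κ`. There are at most
`κ ^ (< κ) = κ` of them. Adding them to the space as isolated points, and taking the topology of
the tree, gives a `κ`-additive `SC_κ`-space (`PartitionTree.Branches`). The inclusion respects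
`κ`-Borel sets in both directions, and it can be made onto by changing it at `κ` many points
(`kBorelIso_of_injective`). Spaces with fewer than `κ` points are made discrete instead.
-/

namespace GenPolish

/-! ### Cardinal arithmetic below `κ` -/

section Cardinals

variable {κ : Cardinal.{u}}

theorem mk_image_Iio_lt {A : Type u} {α : Ordinal.{u}} (hα : α < κ.ord) (f : Ordinal.{u} → A) :
    #(f '' Iio α) < κ := by
  have h := mk_image_le_lift (f := f) (s := Iio α)
  rw [Cardinal.mk_Iio_ordinal, Cardinal.lift_lift] at h
  exact (Cardinal.lift_le.1 h).trans_lt (lt_ord.1 hα)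

theorem mk_Iio_lt_self (k : κ.ord.ToType) : #(Iio k) < κ := by
  have := Cardinal.mk_Iio_lt k (by simp)
  rwa [mk_ord_toType] at this

theorem mk_Iic_lt_self (hinf : ℵ₀ ≤ κ) (k : κ.ord.ToType) : #(Iic k) < κ := by
  rw [← Iio_insert]
  exact (mk_insert_le).trans_lt (add_lt_of_lt hinf (mk_Iio_lt_self k)
    (one_lt_aleph0.trans_le hinf))

/-- A family of fewer than `κ` elements of the well-order `κ` is bounded. -/
theorem exists_forall_lt_of_mk_lt (hreg : κ.IsRegular) {ι : Type u} (hι : #ι < κ)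
    (f : ι → κ.ord.ToType) : ∃ k, ∀ i, f i < k := by
  by_contra! h
  have hc : IsCofinal (range f) := fun k => by
    obtain ⟨i, hi⟩ := h k
    exact ⟨f i, mem_range_self i, hi⟩
  have h1 := Order.cof_le hc
  rw [cof_toType, hreg.cof_ord] at h1
  exact (h1.trans mk_range_le).not_gt hι

/-- By regularity each function is bounded, and there are at most `2 ^< κ` functions below a given
bound. -/
theorem mk_pi_le_of_two_powerlt (hreg : κ.IsRegular) (hpow : (2 : Cardinal.{u}) ^< κ = κ)
    {ι : Type u} (hι : #ι < κ) : #(ι → κ.ord.ToType) ≤ κ := by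
  have hinf := hreg.aleph0_le
  let F : (Σ k : κ.ord.ToType, (ι → Iio k)) → (ι → κ.ord.ToType) :=
    fun p i => (p.2 i : κ.ord.ToType)
  have hF : Function.Surjective F := fun f => by
    obtain ⟨k, hk⟩ := exists_forall_lt_of_mk_lt hreg hι f
    exact ⟨⟨k, fun i => ⟨f i, hk i⟩⟩, rfl⟩
  refine (mk_le_of_surjective hF).trans ?_
  rw [mk_sigma]
  refine (sum_le_sum _ (fun _ => κ) fun k => ?_).trans ?_
  · rw [mk_arrow, Cardinal.lift_id, Cardinal.lift_id]
    have hk := mk_Iio_lt_self k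
    calc #(Iio k) ^ #ι ≤ (2 ^ #(Iio k)) ^ #ι := power_le_power_right (cantor _).le
      _ = 2 ^ (#(Iio k) * #ι) := by rw [power_mul]
      _ ≤ 2 ^< κ := le_powerlt 2 (mul_lt_of_lt hinf hk hι)
      _ = κ := hpow
  · simp [mul_eq_self hinf]

/-- A product of fewer than `κ` sets of size at most `κ` has size at most `κ`. -/
theorem mk_pi_le (hreg : κ.IsRegular) (hpow : (2 : Cardinal.{u}) ^< κ = κ)
    {ι : Type u} (hι : #ι < κ) {A : Type u} (s : ι → Set A) (hs : ∀ i, #(s i) ≤ κ) :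
    #{f : ι → A | ∀ i, f i ∈ s i} ≤ κ := by
  have h (i : ι) : Nonempty (s i ↪ κ.ord.ToType) := by
    rw [← le_def, mk_ord_toType]; exact hs i
  refine (mk_le_of_injective (f := fun (f : {f : ι → A | ∀ i, f i ∈ s i}) i =>
    (h i).some ⟨f.1 i, f.2 i⟩) ?_).trans (mk_pi_le_of_two_powerlt hreg hpow hι)
  intro f g hfg
  ext i
  have := (h i).some.injective (congrFun hfg i)
  exact congrArg Subtype.val this

theorem mk_iUnion_le_of_le (hinf : ℵ₀ ≤ κ) {ι A : Type u} (hι : #ι ≤ κ) (s : ι → Set A)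
    (hs : ∀ i, #(s i) ≤ κ) : #(⋃ i, s i) ≤ κ := by
  refine (mk_iUnion_le_sum_mk).trans ((sum_le_sum _ (fun _ => κ) hs).trans ?_)
  simp only [sum_const, Cardinal.lift_id]
  exact (mul_le_mul_left hι κ).trans (mul_eq_self hinf).le

end Cardinals

/-! ### Additive spaces -/

section Additive

variable {κ : Cardinal.{u}} {X : Type u} [TopologicalSpace X]

theorem IsAdditive.isOpen_iInter (h : IsAdditive κ X) {ι : Type u} (hι : #ι < κ) {f : ι → Set X}
    (hf : ∀ i, IsOpen (f i)) : IsOpen (⋂ i, f i) := by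
  rw [← sInter_range]
  exact h _ (mk_range_le.trans_lt hι) (by rintro _ ⟨i, rfl⟩; exact hf i)

theorem IsAdditive.isOpen_biInter_lt (h : IsAdditive κ X) {α : Ordinal.{u}} (hα : α < κ.ord)
    {f : Ordinal.{u} → Set X} (hf : ∀ β < α, IsOpen (f β)) : IsOpen (⋂ β < α, f β) := by
  have : ⋂ β < α, f β = ⋂₀ (f '' Iio α) := by
    rw [sInter_image]; rfl
  rw [this]
  exact h _ (mk_image_Iio_lt hα f) (by rintro _ ⟨β, hβ, rfl⟩; exact hf β hβ)

/-- An additive regular space is zero-dimensional: the intersection of a sequence of open sets,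
each containing the closure of the next one, is clopen. -/
theorem IsAdditive.exists_isClopen [RegularSpace X] (h : IsAdditive κ X) (hunc : ℵ₀ < κ)
    {x : X} {U : Set X} (hU : IsOpen U) (hx : x ∈ U) : ∃ W, IsClopen W ∧ x ∈ W ∧ W ⊆ U := by
  have step (V : {V : Set X // IsOpen V ∧ x ∈ V}) :
      ∃ W : {V : Set X // IsOpen V ∧ x ∈ V}, closure W.1 ⊆ V.1 := by
    obtain ⟨C, hC, hCc, hCV⟩ := exists_mem_nhds_isClosed_subset (V.2.1.mem_nhds V.2.2)
    exact ⟨⟨interior C, isOpen_interior, mem_interior_iff_mem_nhds.2 hC⟩,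
      (closure_minimal interior_subset hCc).trans hCV⟩
  choose s hs using step
  let V : ℕ → {V : Set X // IsOpen V ∧ x ∈ V} := fun n => s^[n] ⟨U, hU, hx⟩
  have hV (n : ℕ) : closure (V (n + 1)).1 ⊆ (V n).1 := by
    simp only [V, Function.iterate_succ_apply']
    exact hs _
  have heq : ⋂ n, (V n).1 = ⋂ n, closure (V n).1 :=
    subset_antisymm (iInter_mono fun n => subset_closure)
      (subset_iInter fun n => (iInter_subset _ (n + 1)).trans (hV n))
  refine ⟨⋂ n, (V n).1, ⟨?_, ?_⟩, mem_iInter.2 fun n => (V n).2.2, iInter_subset _ 0⟩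
  · rw [heq]
    exact isClosed_iInter fun n => isClosed_closure
  · have : ⋂ n, (V n).1 = ⋂ n : ULift.{u} ℕ, (V n.down).1 :=
      (Equiv.ulift.surjective.iInter_comp fun n => (V n).1).symm
    rw [this]
    exact h.isOpen_iInter (by simpa using hunc) fun n => (V n.down).2.1

end Additive

/-! ### The `κ`-Borel sets -/

section Borel

variable {κ : Cardinal.{u}} {X Y : Type u} [TopologicalSpace X] [TopologicalSpace Y]

theorem isSuccAlgebra_bor : IsSuccAlgebra κ (Bor κ X) :=
  ⟨fun B hB A hA hU => hA.1 B (hB A hA hU),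
    fun S hS hc A hA hU => hA.2 S (fun _ hB => hS hB A hA hU) hc⟩

theorem bor_of_isOpen {U : Set X} (hU : IsOpen U) : U ∈ Bor κ X := fun _ _ h => h U hU

theorem bor_compl {B : Set X} (hB : B ∈ Bor κ X) : Bᶜ ∈ Bor κ X := isSuccAlgebra_bor.1 B hB

theorem bor_of_isClosed {F : Set X} (hF : IsClosed F) : F ∈ Bor κ X :=
  compl_compl F ▸ bor_compl (bor_of_isOpen hF.isOpen_compl)

theorem bor_sUnion {S : Set (Set X)} (hS : #S ≤ κ) (h : ∀ B ∈ S, B ∈ Bor κ X) :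
    ⋃₀ S ∈ Bor κ X :=
  isSuccAlgebra_bor.2 S h (Order.lt_succ_of_le hS)

theorem bor_sInter {S : Set (Set X)} (hS : #S ≤ κ) (h : ∀ B ∈ S, B ∈ Bor κ X) :
    ⋂₀ S ∈ Bor κ X := by
  rw [sInter_eq_compl_sUnion_compl]
  refine bor_compl (bor_sUnion (mk_image_le.trans hS) ?_)
  rintro _ ⟨B, hB, rfl⟩
  exact bor_compl (h B hB)

theorem bor_union (hκ : ℵ₀ ≤ κ) {A B : Set X} (hA : A ∈ Bor κ X) (hB : B ∈ Bor κ X) :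
    A ∪ B ∈ Bor κ X := by
  rw [← sUnion_pair]
  refine bor_sUnion ?_ (by simp [hA, hB])
  exact (lt_aleph0_iff_set_finite.2 (toFinite {A, B})).le.trans hκ

theorem bor_inter (hκ : ℵ₀ ≤ κ) {A B : Set X} (hA : A ∈ Bor κ X) (hB : B ∈ Bor κ X) :
    A ∩ B ∈ Bor κ X := by
  rw [← compl_compl (A ∩ B), compl_inter]
  exact bor_compl (bor_union hκ (bor_compl hA) (bor_compl hB))

theorem bor_of_mk_le [T1Space X] {S : Set X} (hS : #S ≤ κ) : S ∈ Bor κ X := by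
  have : S = ⋃₀ (singleton '' S) := by simp
  rw [this]
  refine bor_sUnion (mk_image_le.trans hS) ?_
  rintro _ ⟨x, -, rfl⟩
  exact bor_of_isClosed isClosed_singleton

theorem isSuccAlgebra_preimage {Z : Type u} (f : X → Z) :
    IsSuccAlgebra κ {B : Set Z | f ⁻¹' B ∈ Bor κ X} := by
  refine ⟨fun B hB => bor_compl hB, fun S hS hc => ?_⟩
  change f ⁻¹' ⋃₀ S ∈ Bor κ X
  rw [preimage_sUnion, ← sUnion_image]
  refine bor_sUnion (mk_image_le.trans (Order.lt_succ_iff.1 hc)) ?_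
  rintro _ ⟨B, hB, rfl⟩
  exact hS hB

/-- It suffices to check `κ`-Borel measurability of a map on a basis of size at most `κ`. -/
theorem preimage_mem_bor {f : X → Y} {𝓑 : Set (Set Y)}
    (h𝓑 : TopologicalSpace.IsTopologicalBasis 𝓑) (hc : #𝓑 ≤ κ)
    (hf : ∀ U ∈ 𝓑, f ⁻¹' U ∈ Bor κ X) {B : Set Y} (hB : B ∈ Bor κ Y) : f ⁻¹' B ∈ Bor κ X := by
  refine hB _ (isSuccAlgebra_preimage f) fun U hU => ?_
  obtain ⟨S, hS, rfl⟩ := h𝓑.open_eq_sUnion hU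
  exact (isSuccAlgebra_preimage f).2 S (fun V hV => hf V (hS hV))
    (Order.lt_succ_of_le ((mk_le_mk_of_subset hS).trans hc))

/-- An injection with `κ`-Borel image that maps open sets to `κ`-Borel sets maps `κ`-Borel sets
to `κ`-Borel sets. -/
theorem image_mem_bor (hκ : ℵ₀ ≤ κ) {f : X → Y} (hf : f.Injective) (hr : range f ∈ Bor κ Y)
    (ho : ∀ U, IsOpen U → f '' U ∈ Bor κ Y) {B : Set X} (hB : B ∈ Bor κ X) :
    f '' B ∈ Bor κ Y := by
  refine hB {B : Set X | f '' B ∈ Bor κ Y} ⟨fun B hB => ?_, fun S hS hc => ?_⟩ ho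
  · change f '' Bᶜ ∈ Bor κ Y
    rw [image_compl_eq_range_sdiff_image hf]
    exact bor_inter hκ hr (bor_compl hB)
  · change f '' ⋃₀ S ∈ Bor κ Y
    rw [image_sUnion]
    refine bor_sUnion (mk_image_le.trans (Order.lt_succ_iff.1 hc)) ?_
    rintro _ ⟨B, hB, rfl⟩
    exact hS hB

theorem KBorelIso.symm (h : KBorelIso κ X Y) : KBorelIso κ Y X := by
  obtain ⟨f, h1, h2⟩ := h
  exact ⟨f.symm, h2, h1⟩

end Borel

/-! ### Coverings and basic pairs in spaces of weight at most `κ` -/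

section Cover

variable {κ : Cardinal.{u}} {X : Type u} [TopologicalSpace X]

/-- An open cover of a subset of a space of weight `≤ κ` has a subcover of size `≤ κ`. -/
theorem WeightLE.exists_subcover (hw : WeightLE κ X) {c : Set X} {W : X → Set X}
    (hW : ∀ y ∈ c, IsOpen (W y) ∧ y ∈ W y) :
    ∃ D ⊆ c, #D ≤ κ ∧ ∀ x ∈ c, ∃ y ∈ D, x ∈ W y := by
  classical
  obtain ⟨𝓑, h𝓑, hc⟩ := hw
  have h (y : c) : ∃ B : 𝓑, y.1 ∈ B.1 ∧ B.1 ⊆ W y := by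
    obtain ⟨B, hB, hyB, hBW⟩ := h𝓑.exists_subset_of_mem_open (hW y y.2).2 (hW y y.2).1
    exact ⟨⟨B, hB⟩, hyB, hBW⟩
  choose B hB1 hB2 using h
  -- one centre for each of the basic sets used
  choose s hs using fun b : range B => b.2
  refine ⟨range fun b => (s b).1, by rintro _ ⟨b, rfl⟩; exact (s b).2,
    mk_range_le.trans ((mk_set_le _).trans hc), fun x hx => ?_⟩
  refine ⟨_, mem_range_self ⟨B ⟨x, hx⟩, mem_range_self _⟩, hB2 _ ?_⟩
  rw [hs]
  exact hB1 ⟨x, hx⟩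

/-- Disjointification of an open cover `W` of `c`: to each point of `c` a representative `ρ x` is
assigned, the first one with `x ∈ W (ρ x)` in a well-order of type at most `κ`. -/
theorem WeightLE.exists_disjoint_refinement (hw : WeightLE κ X) {c : Set X} {W : X → Set X}
    (hW : ∀ y ∈ c, IsOpen (W y) ∧ y ∈ W y) :
    ∃ ρ : X → X, (∀ x ∈ c, ρ x ∈ c ∧ x ∈ W (ρ x)) ∧ #(ρ '' c) ≤ κ ∧
      ∀ x ∈ c, ∃ F, IsClosed F ∧ {y ∈ c | ρ y = ρ x} = c ∩ W (ρ x) ∩ F ∧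
        (IsAdditive κ X → (∀ y ∈ c, IsClosed (W y)) → IsOpen F) := by
  classical
  obtain ⟨D, hDc, hD, hcov⟩ := hw.exists_subcover hW
  obtain ⟨⟨e, he⟩⟩ : Nonempty (D ↪ κ.ord.ToType) := by
    rwa [← le_def, mk_ord_toType]
  have hex (x : c) : ∃ y : D, x.1 ∈ W y ∧ ∀ z : D, e z < e y → x.1 ∉ W z := by
    obtain ⟨y, hy, hxy⟩ := hcov x x.2
    obtain ⟨y, hy, hmin⟩ :=
      (InvImage.wf e wellFounded_lt).has_min {y : D | x.1 ∈ W y} ⟨⟨y, hy⟩, hxy⟩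
    exact ⟨y, hy, fun z hz hxz => hmin z hxz hz⟩
  choose f hf1 hf2 using hex
  have huniq (x : c) (y : D) (h1 : x.1 ∈ W y) (h2 : ∀ z : D, e z < e y → x.1 ∉ W z) : f x = y := by
    rcases lt_trichotomy (e (f x)) (e y) with h | h | h
    · exact absurd (hf1 x) (h2 _ h)
    · exact he h
    · exact absurd h1 (hf2 x _ h)
  let ρ : X → X := fun x => if h : x ∈ c then f ⟨x, h⟩ else x
  have hρ (x : X) (h : x ∈ c) : ρ x = f ⟨x, h⟩ := dif_pos h
  refine ⟨ρ, fun x hx => ?_, ?_, fun x hx => ?_⟩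
  · rw [hρ x hx]
    exact ⟨hDc (f _).2, hf1 ⟨x, hx⟩⟩
  · refine (mk_le_mk_of_subset ?_).trans hD
    rintro _ ⟨x, hx, rfl⟩
    rw [hρ x hx]
    exact (f _).2
  · refine ⟨⋂ z : {z : D // e z < e (f ⟨x, hx⟩)}, (W z.1)ᶜ, ?_, ?_, ?_⟩
    · exact isClosed_iInter fun z => (hW _ (hDc z.1.2)).1.isClosed_compl
    · ext y
      simp only [mem_ofPred_eq, mem_inter_iff, mem_iInter, mem_compl_iff]
      constructor
      · rintro ⟨hy, hyx⟩
        rw [hρ y hy, hρ x hx, ← Subtype.ext_iff] at hyx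
        rw [hρ x hx, ← hyx]
        exact ⟨⟨hy, hf1 _⟩, fun z => hf2 ⟨y, hy⟩ z.1 z.2⟩
      · rintro ⟨⟨hy, hyx⟩, hz⟩
        rw [hρ x hx] at hyx
        refine ⟨hy, ?_⟩
        rw [hρ y hy, hρ x hx, huniq ⟨y, hy⟩ _ hyx fun z h => hz ⟨z, h⟩]
    · intro hadd hcl
      refine hadd.isOpen_iInter ?_ fun z => (hcl _ (hDc z.1.2)).isOpen_compl
      refine (mk_le_of_injective (f := fun z => (⟨e z.1, z.2⟩ : Iio (e (f ⟨x, hx⟩)))) ?_).trans_lt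
        (mk_Iio_lt_self _)
      intro z w h
      exact Subtype.ext (he (congrArg Subtype.val h))

/-- In a regular space of weight `≤ κ` there is a sequence of pairs `P α ⊆ Q α`, of a closed and
an open set, in which arbitrarily small neighbourhoods of each point occur cofinally often. -/
theorem WeightLE.exists_pairs [RegularSpace X] (hreg : κ.IsRegular) (hw : WeightLE κ X) :
    ∃ P Q : Ordinal.{u} → Set X, (∀ α, IsClosed (P α) ∧ IsOpen (Q α) ∧ P α ⊆ Q α) ∧
      ∀ (x : X) (O : Set X), IsOpen O → x ∈ O → ∀ β < κ.ord,
        ∃ α, β < α ∧ α < κ.ord ∧ x ∈ P α ∧ Q α ⊆ O := by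
  classical
  obtain ⟨𝓑, h𝓑, hc⟩ := hw
  have hinf := hreg.aleph0_le
  obtain ⟨e⟩ : Nonempty ((𝓑 × 𝓑) × κ.ord.ToType ↪ κ.ord.ToType) := by
    rw [← le_def]
    simp only [mk_prod, Cardinal.lift_id, mk_ord_toType]
    calc #𝓑 * #𝓑 * κ ≤ κ * κ * κ := by gcongr
      _ = κ := by rw [mul_eq_self hinf, mul_eq_self hinf]
  let o : (𝓑 × 𝓑) × κ.ord.ToType → Ordinal.{u} := fun p => (ToType.toOrd (e p) : Ordinal)
  have ho : o.Injective := fun p q h => e.injective (ToType.mk.symm.injective (Subtype.ext h))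
  have ho' (p) : o p < κ.ord := (ToType.toOrd (e p)).2
  let good (α : Ordinal.{u}) (p : (𝓑 × 𝓑) × κ.ord.ToType) : Prop :=
    o p = α ∧ closure p.1.1.1 ⊆ p.1.2.1
  let P : Ordinal.{u} → Set X := fun α =>
    if h : ∃ p, good α p then closure h.choose.1.1.1 else ∅
  let Q : Ordinal.{u} → Set X := fun α => if h : ∃ p, good α p then h.choose.1.2.1 else ∅
  refine ⟨P, Q, fun α => ?_, fun x O hO hx β hβ => ?_⟩
  · by_cases h : ∃ p, good α p
    · simp only [P, Q, dif_pos h]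
      exact ⟨isClosed_closure, h𝓑.isOpen h.choose.1.2.2, h.choose_spec.2⟩
    · simp only [P, Q, dif_neg h]
      exact ⟨isClosed_empty, isOpen_empty, subset_rfl⟩
  · obtain ⟨V, hV, hxV, hVO⟩ := h𝓑.exists_subset_of_mem_open hx hO
    obtain ⟨C, hC, hCc, hCV⟩ := exists_mem_nhds_isClosed_subset ((h𝓑.isOpen hV).mem_nhds hxV)
    obtain ⟨B, hB, hxB, hBC⟩ := h𝓑.mem_nhds_iff.1 hC
    have hcl : closure B ⊆ V := (closure_minimal hBC hCc).trans hCV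
    -- the pair `(B, V)` occurs at `κ` many places
    obtain ⟨k, hk⟩ : ∃ k, β < o ((⟨B, hB⟩, ⟨V, hV⟩), k) := by
      by_contra! h
      have hβ' : Order.succ β < κ.ord := (isSuccLimit_ord hinf).succ_lt hβ
      refine (mk_image_Iio_lt hβ' fun α => if h : ∃ k, o ((⟨B, hB⟩, ⟨V, hV⟩), k) = α then
        some h.choose else none).not_ge ?_
      refine (mk_ord_toType κ).symm.le.trans <| mk_le_of_injective
        (f := fun k => ⟨some k, _, mem_Iio.2 (Order.lt_succ_of_le (h k)), ?_⟩) ?_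
      · have hk : ∃ k', o ((⟨B, hB⟩, ⟨V, hV⟩), k') = o ((⟨B, hB⟩, ⟨V, hV⟩), k) := ⟨k, rfl⟩
        exact (dif_pos hk).trans (congrArg some (Prod.ext_iff.1 (ho hk.choose_spec)).2)
      · intro k l h
        exact Option.some_injective _ (congrArg Subtype.val h)
    have hg : ∃ p, good (o ((⟨B, hB⟩, ⟨V, hV⟩), k)) p := ⟨_, rfl, hcl⟩
    have hg' := ho hg.choose_spec.1
    refine ⟨_, hk, ho' _, ?_, ?_⟩
    · simp only [P, dif_pos hg, hg']
      exact subset_closure hxB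
    · simp only [Q, dif_pos hg, hg']
      exact hVO

end Cover

/-! ### Runs of the game that agree on an initial segment -/

section Runs

variable {X : Type u} {σ : Strategy X} {p q : Ordinal.{u} → Set X × X} {α : Ordinal.{u}}

theorem Strategy.reply_congr (h : ∀ β ≤ α, p β = q β) : σ.reply p α = σ.reply q α := by
  unfold Strategy.reply
  congr 1
  funext β
  exact h β β.2

theorem Strategy.stage_congr (h : ∀ β < α, p β = q β) : σ.stage p α = σ.stage q α := by
  unfold Strategy.stage
  exact iInter₂_congr fun β hβ => reply_congr fun γ hγ => h γ (hγ.trans_lt hβ)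

theorem Strategy.LegalI.congr [TopologicalSpace X] (hp : σ.LegalI p α) (h : ∀ β ≤ α, p β = q β) :
    σ.LegalI q α := by
  unfold Strategy.LegalI at *
  rwa [← stage_congr fun β hβ => h β hβ.le, ← h α le_rfl]

theorem mem_stage {z : X} : z ∈ σ.stage p α ↔ ∀ β < α, z ∈ σ.reply p β := by
  simp [Strategy.stage]

/-- Player II never breaks the rules when he follows `σ` in a run of length at most `κ`. -/
def Strategy.Obeys [TopologicalSpace X] (κ : Cardinal.{u}) (σ : Strategy X) : Prop :=
  ∀ (p : Ordinal.{u} → Set X × X) (γ : Ordinal.{u}), γ ≤ κ.ord → (∀ α < γ, σ.LegalI p α) →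
    ∀ α < γ, σ.LegalII p α

end Runs

/-! ### One step of the construction of a tree of partitions -/

section Step

variable {κ : Cardinal.{u}} {X : Type u} [TopologicalSpace X]

/-- The requirements on a partition of the cell `c`, where `S` is what is left of the space in the
current run of the game and `r` is the reply function of player II. To `x ∈ c` the map `g` assigns
a move of player I and the cell of `x` in the new partition. The set `c` is cut out of the answer
of player II by a closed set, and player I decides between the two complementary conditions given
by the closed set `P` and its neighbourhood `Q`. -/
structure StepSpec (κ : Cardinal.{u}) (P Q S c : Set X) (r : Set X × X → Set X)
    (g : X → (Set X × X) × Set X) : Prop where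
  card_le : #(g '' c) ≤ κ
  relOpen : ∀ x ∈ c, RelOpen S (g x).1.1
  mem_move : ∀ x ∈ c, (g x).1.2 ∈ (g x).1.1
  move_subset : IsOpen c → ∀ x ∈ c, (g x).1.1 ⊆ c
  point_mem : ∀ x ∈ c, (g x).1.2 ∈ c
  point_mem_or_disjoint : ∀ x ∈ c, (g x).1.2 ∈ P ∧ (g x).1.1 ⊆ Q ∨ Disjoint (g x).1.1 P
  mem_cell : ∀ x ∈ c, x ∈ (g x).2
  eq_of_mem : ∀ x ∈ c, ∀ y ∈ (g x).2, g y = g x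
  cell_eq : ∀ x ∈ c, ∃ F, IsClosed F ∧ (g x).2 = c ∩ r (g x).1 ∩ F
  isOpen_cell : IsAdditive κ X → IsOpen c → ∀ x ∈ c, IsOpen (g x).2

/-- If the space is additive, then the replies of player II can be shrunk to clopen sets, and
this makes the new cells open; in general the cells are only relatively locally closed. -/
theorem exists_stepSpec [RegularSpace X] (hunc : ℵ₀ < κ) (hw : WeightLE κ X)
    {P Q S c : Set X} {r : Set X × X → Set X} (hP : IsClosed P) (hQ : IsOpen Q) (hPQ : P ⊆ Q)
    (hcS : c ⊆ S)
    (hr : ∀ m : Set X × X, RelOpen S m.1 → m.2 ∈ m.1 →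
      RelOpen S (r m) ∧ m.2 ∈ r m ∧ r m ⊆ m.1) :
    ∃ g, StepSpec κ P Q S c r g := by
  classical
  obtain ⟨T, hcT, hT, hTc⟩ : ∃ T, c ⊆ T ∧ RelOpen S T ∧ (IsOpen c → T ⊆ c) := by
    by_cases hc : IsOpen c
    · exact ⟨c, subset_rfl, ⟨c, hc, (inter_eq_right.2 hcS).symm⟩, fun _ => subset_rfl⟩
    · exact ⟨S, hcS, ⟨univ, isOpen_univ, (inter_univ S).symm⟩, fun h => absurd h hc⟩
  obtain ⟨O, hO, rfl⟩ := hT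
  let U : X → Set X := fun y => S ∩ O ∩ if y ∈ P then Q else Pᶜ
  have hU (y : X) : RelOpen S (U y) := by
    refine ⟨O ∩ if y ∈ P then Q else Pᶜ, hO.inter ?_, inter_assoc _ _ _⟩
    split_ifs
    exacts [hQ, hP.isOpen_compl]
  have hyU (y : X) (hy : y ∈ c) : y ∈ U y := by
    refine ⟨hcT hy, ?_⟩
    split_ifs with h
    exacts [hPQ h, h]
  have hW (y : X) (hy : y ∈ c) : ∃ W H, IsOpen W ∧ IsClosed H ∧ y ∈ W ∧ S ∩ W = r (U y, y) ∩ H ∧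
      (IsAdditive κ X → IsClosed W) := by
    obtain ⟨⟨W, hWo, hWr⟩, hyr, -⟩ := hr (U y, y) (hU y) (hyU y hy)
    by_cases hadd : IsAdditive κ X
    · obtain ⟨W', hW'c, hyW', hW'W⟩ := hadd.exists_isClopen hunc hWo (hWr ▸ hyr).2
      refine ⟨W', W', hW'c.isOpen, hW'c.isClosed, hyW', ?_, fun _ => hW'c.isClosed⟩
      rw [hWr, inter_assoc, inter_eq_right.2 hW'W]
    · exact ⟨W, univ, hWo, isClosed_univ, (hWr ▸ hyr).2, by rw [hWr, inter_univ],
        fun h => absurd h hadd⟩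
  choose! W H hWo hH hyW hWH hWc using hW
  obtain ⟨ρ, hρ, hρc, hρF⟩ := hw.exists_disjoint_refinement fun y hy => ⟨hWo y hy, hyW y hy⟩
  refine ⟨fun x => ((U (ρ x), ρ x), {y ∈ c | ρ y = ρ x}), ?_, fun x _ => hU _,
    fun x hx => hyU _ (hρ x hx).1, fun hc x _ => inter_subset_left.trans (hTc hc),
    fun x hx => (hρ x hx).1, fun x _ => ?_, fun x hx => ⟨hx, rfl⟩, fun x _ y hy => ?_,
    fun x hx => ?_, fun hadd hc x hx => ?_⟩
  · refine (mk_le_mk_of_subset ?_).trans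
      ((mk_image_le (f := fun z => ((U z, z), {y ∈ c | ρ y = z})) (s := ρ '' c)).trans hρc)
    rw [image_image]
  · dsimp only [U]
    split_ifs with h
    · exact Or.inl ⟨h, inter_subset_right⟩
    · exact Or.inr (disjoint_compl_left.mono_left inter_subset_right)
  · rw [hy.2]
  · obtain ⟨F, hF, hFe, -⟩ := hρF x hx
    refine ⟨H (ρ x) ∩ F, (hH _ (hρ x hx).1).inter hF, ?_⟩
    dsimp only
    rw [hFe, ← inter_assoc, inter_assoc c (r _), ← hWH _ (hρ x hx).1, ← inter_assoc,
      inter_eq_left.2 hcS]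
  · obtain ⟨F, -, hFe, hFo⟩ := hρF x hx
    dsimp only
    rw [hFe]
    exact (hc.inter (hWo _ (hρ x hx).1)).inter (hFo hadd fun y hy => hWc y hy hadd)

end Step

/-! ### The tree of partitions given by a strategy -/

section Node

variable {κ : Cardinal.{u}} {X : Type u} [TopologicalSpace X]

open Classical in
/-- A partition as required by `StepSpec`, if there is one. It depends on the history of the
construction only through the sets `S`, `c` and the reply function `r`. -/
noncomputable def chosenStep (κ : Cardinal.{u}) (P Q S c : Set X) (r : Set X × X → Set X) :
    X → (Set X × X) × Set X :=
  if h : ∃ g, StepSpec κ P Q S c r g then h.choose else fun x => ((∅, x), ∅)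

open Classical in
/-- Player I's move at round `α` in the run that leads to `x`, together with the cell of `x` in
the partition made at that round. The intersections are `σ.stage (play x) α` and the cell of `x`
before the round, written out so that only values below `α` are used; see `node_eq`. -/
noncomputable def node (κ : Cardinal.{u}) (P Q : Ordinal.{u} → Set X) (σ : Strategy X) (x : X)
    (α : Ordinal.{u}) : (Set X × X) × Set X :=
  chosenStep κ (P α) (Q α)
    (⋂ (β) (_ : β < α), σ β fun γ : Iic β => (node κ P Q σ x γ.1).1)
    (⋂ (β) (_ : β < α), (node κ P Q σ x β).2)
    (fun m => σ α fun β : Iic α => if _h : β.1 < α then (node κ P Q σ x β.1).1 else m) x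
termination_by α
decreasing_by
  · exact lt_of_le_of_lt γ.2 ‹_›
  · assumption
  · assumption

variable {P Q : Ordinal.{u} → Set X} {σ : Strategy X}

/-- The run of player I that leads to `x`. -/
noncomputable def play (κ : Cardinal.{u}) (P Q : Ordinal.{u} → Set X) (σ : Strategy X) (x : X)
    (α : Ordinal.{u}) : Set X × X := (node κ P Q σ x α).1

/-- The cell of `x` in the partition made at round `α`. -/
noncomputable def cell (κ : Cardinal.{u}) (P Q : Ordinal.{u} → Set X) (σ : Strategy X) (x : X)
    (α : Ordinal.{u}) : Set X := (node κ P Q σ x α).2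

open Classical in
/-- The answer of player II to the move `m` at round `α` of the run that leads to `x`. -/
noncomputable def answer (κ : Cardinal.{u}) (P Q : Ordinal.{u} → Set X) (σ : Strategy X) (x : X)
    (α : Ordinal.{u}) (m : Set X × X) : Set X :=
  σ.reply (fun β => if β < α then play κ P Q σ x β else m) α

/-- The partition used at round `α` at the node of `x`. -/
noncomputable def stepAt (κ : Cardinal.{u}) (P Q : Ordinal.{u} → Set X) (σ : Strategy X) (x : X)
    (α : Ordinal.{u}) : X → (Set X × X) × Set X :=
  chosenStep κ (P α) (Q α) (σ.stage (play κ P Q σ x) α) (⋂ β < α, cell κ P Q σ x β)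
    (answer κ P Q σ x α)

theorem node_eq (x : X) (α : Ordinal.{u}) : node κ P Q σ x α = stepAt κ P Q σ x α x := by
  rw [node]
  rfl

theorem answer_play (x : X) (α : Ordinal.{u}) :
    answer κ P Q σ x α (play κ P Q σ x α) = σ.reply (play κ P Q σ x) α := by
  refine Strategy.reply_congr fun β hβ => ?_
  split_ifs with h
  · rfl
  · rw [hβ.eq_of_not_lt h]

theorem stepAt_congr {x y : X} {α : Ordinal.{u}}
    (h : ∀ β < α, node κ P Q σ y β = node κ P Q σ x β) :
    stepAt κ P Q σ y α = stepAt κ P Q σ x α := by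
  have hp : ∀ β < α, play κ P Q σ y β = play κ P Q σ x β := fun β hβ => congrArg Prod.fst (h β hβ)
  have hc : ∀ β < α, cell κ P Q σ y β = cell κ P Q σ x β := fun β hβ => congrArg Prod.snd (h β hβ)
  unfold stepAt
  rw [Strategy.stage_congr hp, iInter₂_congr hc]
  congr 1
  funext m
  refine Strategy.reply_congr fun β _ => ?_
  split_ifs with hβ
  · exact hp β hβ
  · rfl

/-- What is known about the pairs `(P α, Q α)`; see `WeightLE.exists_pairs`. -/
structure IsPairing (κ : Cardinal.{u}) (P Q : Ordinal.{u} → Set X) : Prop where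
  isClosed : ∀ α, IsClosed (P α)
  isOpen : ∀ α, IsOpen (Q α)
  subset : ∀ α, P α ⊆ Q α
  exists_gt : ∀ (x : X) (O : Set X), IsOpen O → x ∈ O → ∀ β < κ.ord,
    ∃ α, β < α ∧ α < κ.ord ∧ x ∈ P α ∧ Q α ⊆ O

/-- The hypotheses under which the tree of partitions is studied. -/
structure TreeData (κ : Cardinal.{u}) (P Q : Ordinal.{u} → Set X) (σ : Strategy X) : Prop where
  isRegular : κ.IsRegular
  aleph0_lt : ℵ₀ < κ
  regularSpace : RegularSpace X
  weight_le : WeightLE κ X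
  pairing : IsPairing κ P Q
  obeys : σ.Obeys κ

/-- All the rounds of the construction below `κ` succeed. The claims are proved simultaneously,
since the existence of a partition at round `α` needs the runs up to `α` to be legal. -/
theorem TreeData.step_succeeds (h : TreeData κ P Q σ) (α : Ordinal.{u}) (hα : α < κ.ord) (x : X) :
    StepSpec κ (P α) (Q α) (σ.stage (play κ P Q σ x) α) (⋂ β < α, cell κ P Q σ x β)
      (answer κ P Q σ x α) (stepAt κ P Q σ x α) ∧ x ∈ cell κ P Q σ x α ∧
      (∀ y ∈ cell κ P Q σ x α, node κ P Q σ y α = node κ P Q σ x α) ∧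
      cell κ P Q σ x α ⊆ ⋂ β < α, cell κ P Q σ x β := by
  classical
  induction α using WellFoundedLT.induction generalizing x with
  | ind α ih =>
  have hxc : x ∈ ⋂ β < α, cell κ P Q σ x β :=
    mem_iInter₂.2 fun β hβ => (ih β hβ (hβ.trans hα) x).2.1
  have hspec : StepSpec κ (P α) (Q α) (σ.stage (play κ P Q σ x) α) (⋂ β < α, cell κ P Q σ x β)
      (answer κ P Q σ x α) (stepAt κ P Q σ x α) := by
    have hex : ∃ g, StepSpec κ (P α) (Q α) (σ.stage (play κ P Q σ x) α)
        (⋂ β < α, cell κ P Q σ x β) (answer κ P Q σ x α) g := by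
      have := h.regularSpace
      refine exists_stepSpec h.aleph0_lt h.weight_le (h.pairing.isClosed α) (h.pairing.isOpen α)
        (h.pairing.subset α) ?_ ?_
      · refine iInter₂_mono fun β hβ => ?_
        obtain ⟨hs, -⟩ := ih β hβ (hβ.trans hα) x
        obtain ⟨F, -, hF⟩ := hs.cell_eq x
          (mem_iInter₂.2 fun γ hγ => (ih γ (hγ.trans hβ) ((hγ.trans hβ).trans hα) x).2.1)
        rw [← node_eq] at hF
        rw [← answer_play]
        change (node κ P Q σ x β).2 ⊆ _
        rw [hF]
        exact inter_subset_left.trans inter_subset_right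
      · intro m hm1 hm2
        let q : Ordinal.{u} → Set X × X := fun β => if β < α then play κ P Q σ x β else m
        have hq (β : Ordinal.{u}) (hβ : β < α) : play κ P Q σ x β = q β := (if_pos hβ).symm
        have hqα : q α = m := if_neg (lt_irrefl α)
        have hst : σ.stage q α = σ.stage (play κ P Q σ x) α :=
          (Strategy.stage_congr hq).symm
        have := h.obeys q (Order.succ α)
          ((isSuccLimit_ord h.aleph0_lt.le).succ_lt hα).le (fun β hβ => ?_) α (Order.lt_succ α)
        · unfold Strategy.LegalII at this
          rwa [hst, hqα] at this
        · rcases (Order.lt_succ_iff.1 hβ).lt_or_eq with hβ | rfl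
          · have hs := (ih β hβ (hβ.trans hα) x).1
            have hx' : x ∈ ⋂ γ < β, cell κ P Q σ x γ :=
              mem_iInter₂.2 fun γ hγ => (ih γ (hγ.trans hβ) ((hγ.trans hβ).trans hα) x).2.1
            have hl : σ.LegalI (play κ P Q σ x) β := by
              refine ⟨?_, ?_⟩
              · have := hs.relOpen x hx'
                rwa [← node_eq] at this
              · have := hs.mem_move x hx'
                rwa [← node_eq] at this
            exact hl.congr fun γ hγ => hq γ (hγ.trans_lt hβ)
          · unfold Strategy.LegalI
            rw [hst, hqα]
            exact ⟨hm1, hm2⟩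
    unfold stepAt chosenStep
    rw [dif_pos hex]
    exact hex.choose_spec
  have hsub : cell κ P Q σ x α ⊆ ⋂ β < α, cell κ P Q σ x β := by
    obtain ⟨F, -, hF⟩ := hspec.cell_eq x hxc
    rw [← node_eq] at hF
    change (node κ P Q σ x α).2 ⊆ _
    rw [hF]
    exact inter_subset_left.trans inter_subset_left
  refine ⟨hspec, ?_, fun y hy => ?_, hsub⟩
  · have := hspec.mem_cell x hxc
    rwa [← node_eq] at this
  · have hy' := mem_iInter₂.1 (hsub hy)
    rw [node_eq, node_eq, stepAt_congr fun β hβ => (ih β hβ (hβ.trans hα) x).2.2.1 y (hy' β hβ)]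
    refine hspec.eq_of_mem x hxc y ?_
    rwa [← node_eq]

end Node

/-! ### Runs along the branches of the tree -/

section Branches

variable {κ : Cardinal.{u}} {X : Type u} [TopologicalSpace X]
  {P Q : Ordinal.{u} → Set X} {σ : Strategy X}

theorem TreeData.mem_cell (h : TreeData κ P Q σ) {α : Ordinal.{u}} (hα : α < κ.ord) (x : X) :
    x ∈ cell κ P Q σ x α := (h.step_succeeds α hα x).2.1

theorem TreeData.node_eq_of_mem (h : TreeData κ P Q σ) {α : Ordinal.{u}} (hα : α < κ.ord)
    {x y : X} (hy : y ∈ cell κ P Q σ x α) : node κ P Q σ y α = node κ P Q σ x α :=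
  (h.step_succeeds α hα x).2.2.1 y hy

theorem TreeData.cell_eq_of_mem (h : TreeData κ P Q σ) {α : Ordinal.{u}} (hα : α < κ.ord)
    {x y : X} (hy : y ∈ cell κ P Q σ x α) : cell κ P Q σ y α = cell κ P Q σ x α :=
  congrArg Prod.snd (h.node_eq_of_mem hα hy)

theorem TreeData.cell_subset (h : TreeData κ P Q σ) {α : Ordinal.{u}} (hα : α < κ.ord) (x : X)
    {β : Ordinal.{u}} (hβ : β ≤ α) : cell κ P Q σ x α ⊆ cell κ P Q σ x β := by
  rcases hβ.lt_or_eq with hβ | rfl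
  · exact (h.step_succeeds α hα x).2.2.2.trans (iInter₂_subset β hβ)
  · rfl

theorem TreeData.mem_iInter_cell (h : TreeData κ P Q σ) {α : Ordinal.{u}} (hα : α < κ.ord)
    (x : X) : x ∈ ⋂ β < α, cell κ P Q σ x β := (h.step_succeeds α hα x).2.2.2 (h.mem_cell hα x)

theorem TreeData.legalI (h : TreeData κ P Q σ) {α : Ordinal.{u}} (hα : α < κ.ord) (x : X) :
    σ.LegalI (play κ P Q σ x) α := by
  obtain ⟨hs, -⟩ := h.step_succeeds α hα x
  have h1 := hs.relOpen x (h.mem_iInter_cell hα x)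
  have h2 := hs.mem_move x (h.mem_iInter_cell hα x)
  rw [← node_eq] at h1 h2
  exact ⟨h1, h2⟩

theorem TreeData.legalII (h : TreeData κ P Q σ) {α : Ordinal.{u}} (hα : α < κ.ord) (x : X) :
    σ.LegalII (play κ P Q σ x) α :=
  h.obeys _ _ le_rfl (fun _ hβ => h.legalI hβ x) α hα

theorem TreeData.exists_cell_eq (h : TreeData κ P Q σ) {α : Ordinal.{u}} (hα : α < κ.ord)
    (x : X) : ∃ F, IsClosed F ∧
      cell κ P Q σ x α = (⋂ β < α, cell κ P Q σ x β) ∩ σ.reply (play κ P Q σ x) α ∩ F := by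
  obtain ⟨F, hF, he⟩ := (h.step_succeeds α hα x).1.cell_eq x (h.mem_iInter_cell hα x)
  rw [← node_eq] at he
  exact ⟨F, hF, he.trans (by rw [← answer_play, play])⟩

theorem TreeData.point_mem_or_disjoint (h : TreeData κ P Q σ) {α : Ordinal.{u}}
    (hα : α < κ.ord) (x : X) :
    (play κ P Q σ x α).2 ∈ P α ∧ (play κ P Q σ x α).1 ⊆ Q α ∨
      Disjoint (play κ P Q σ x α).1 (P α) := by
  have := (h.step_succeeds α hα x).1.point_mem_or_disjoint x (h.mem_iInter_cell hα x)
  rwa [← node_eq] at this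

theorem TreeData.point_mem (h : TreeData κ P Q σ) {α : Ordinal.{u}} (hα : α < κ.ord) (x : X) :
    (play κ P Q σ x α).2 ∈ ⋂ β < α, cell κ P Q σ x β := by
  have := (h.step_succeeds α hα x).1.point_mem x (h.mem_iInter_cell hα x)
  rwa [← node_eq] at this

theorem TreeData.cell_subset_move (h : TreeData κ P Q σ) {α : Ordinal.{u}} (hα : α < κ.ord)
    (x : X) : cell κ P Q σ x α ⊆ (play κ P Q σ x α).1 := by
  obtain ⟨F, -, hF⟩ := h.exists_cell_eq hα x
  rw [hF]
  exact (inter_subset_left.trans inter_subset_right).trans (h.legalII hα x).2.2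

theorem TreeData.exists_cell_subset (h : TreeData κ P Q σ) {x : X} {O : Set X} (hO : IsOpen O)
    (hx : x ∈ O) : ∃ α < κ.ord, cell κ P Q σ x α ⊆ O := by
  obtain ⟨α, -, hα, hxP, hQO⟩ := h.pairing.exists_gt x O hO hx 0 h.isRegular.ord_pos
  refine ⟨α, hα, (h.cell_subset_move hα x).trans ?_⟩
  rcases h.point_mem_or_disjoint hα x with h1 | h1
  · exact h1.2.trans hQO
  · exact absurd hxP (disjoint_left.1 h1 (h.cell_subset_move hα x (h.mem_cell hα x)))

theorem TreeData.isOpen_cell (h : TreeData κ P Q σ) (hadd : IsAdditive κ X) {α : Ordinal.{u}}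
    (hα : α < κ.ord) (x : X) : IsOpen (cell κ P Q σ x α) := by
  induction α using WellFoundedLT.induction with
  | ind α ih =>
  have := (h.step_succeeds α hα x).1.isOpen_cell hadd
    (hadd.isOpen_biInter_lt hα fun β hβ => ih β hβ (hβ.trans hα)) x (h.mem_iInter_cell hα x)
  rwa [← node_eq] at this

theorem TreeData.move_subset (h : TreeData κ P Q σ) (hadd : IsAdditive κ X) {α : Ordinal.{u}}
    (hα : α < κ.ord) (x : X) :
    (play κ P Q σ x α).1 ⊆ ⋂ β < α, cell κ P Q σ x β := by
  have := (h.step_succeeds α hα x).1.move_subset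
    (hadd.isOpen_biInter_lt hα fun β hβ => h.isOpen_cell hadd (hβ.trans hα) x) x
    (h.mem_iInter_cell hα x)
  rwa [← node_eq] at this

theorem TreeData.cell_mem_bor (h : TreeData κ P Q σ) {α : Ordinal.{u}} (hα : α < κ.ord) (x : X) :
    cell κ P Q σ x α ∈ Bor κ X := by
  induction α using WellFoundedLT.induction with
  | ind α ih =>
  obtain ⟨F, hF, he⟩ := h.exists_cell_eq hα x
  have hinf := h.aleph0_lt.le
  have hc : ⋂ β < α, cell κ P Q σ x β ∈ Bor κ X := by
    have : ⋂ β < α, cell κ P Q σ x β = ⋂₀ (cell κ P Q σ x '' Iio α) := by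
      rw [sInter_image]; rfl
    rw [this]
    refine bor_sInter (mk_image_Iio_lt hα _).le ?_
    rintro _ ⟨β, hβ, rfl⟩
    exact ih β hβ (lt_trans hβ hα)
  obtain ⟨O, hO, hr⟩ := (h.legalII hα x).1
  -- the cell lies in what was left before the round, so the answer may be replaced by an open set
  have hcS : (⋂ β < α, cell κ P Q σ x β) ⊆ σ.stage (play κ P Q σ x) α := by
    refine iInter₂_mono fun β hβ => ?_
    obtain ⟨G, -, hG⟩ := h.exists_cell_eq (hβ.trans hα) x
    rw [hG]
    exact inter_subset_left.trans inter_subset_right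
  rw [he, hr, ← inter_assoc, inter_eq_left.2 hcS]
  exact bor_inter hinf (bor_inter hinf hc (bor_of_isOpen hO)) (bor_of_isClosed hF)

/-- There are at most `κ` nodes at each level, because `κ` to a power below `κ` is `κ`. -/
theorem TreeData.mk_range_node_le (h : TreeData κ P Q σ) (hpow : (2 : Cardinal.{u}) ^< κ = κ)
    (k : κ.ord.ToType) : #(range fun x => node κ P Q σ x (ToType.toOrd k)) ≤ κ := by
  induction k using WellFoundedLT.induction with
  | ind k ih =>
  let L : Set (Iio k → (Set X × X) × Set X) :=
    {f | ∀ j, f j ∈ range fun x => node κ P Q σ x (ToType.toOrd j.1)}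
  have hL : #L ≤ κ := mk_pi_le h.isRegular hpow (mk_Iio_lt_self k) _ fun j => ih j j.2
  have hk : (ToType.toOrd k : Ordinal.{u}) < κ.ord := (ToType.toOrd k).2
  refine (mk_le_mk_of_subset (t := ⋃ f : L, {n | ∃ x, (∀ j : Iio k,
    node κ P Q σ x (ToType.toOrd j.1) = f.1 j) ∧ node κ P Q σ x (ToType.toOrd k) = n}) ?_).trans
    (mk_iUnion_le_of_le h.aleph0_lt.le hL _ fun f => ?_)
  · rintro _ ⟨x, rfl⟩
    exact mem_iUnion.2 ⟨⟨fun j => node κ P Q σ x (ToType.toOrd j.1), fun j => ⟨x, rfl⟩⟩, x,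
      fun j => rfl, rfl⟩
  · rcases eq_empty_or_nonempty {x | ∀ j : Iio k, node κ P Q σ x (ToType.toOrd j.1) = f.1 j} with
      hf | ⟨x, hx⟩
    · refine (mk_le_mk_of_subset (t := ∅) ?_).trans (by simp)
      rintro _ ⟨x, hx, -⟩
      exact hf.le hx
    · refine (mk_le_mk_of_subset ?_).trans (h.step_succeeds _ hk x).1.card_le
      rintro _ ⟨y, hy, rfl⟩
      have hyx : ∀ β < (ToType.toOrd k : Ordinal.{u}), node κ P Q σ y β = node κ P Q σ x β := by
        intro β hβ
        have hj : ToType.mk ⟨β, hβ.trans hk⟩ < k := by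
          rw [← OrderIso.lt_symm_apply]
          exact hβ
        have := (hy ⟨_, hj⟩).trans (hx ⟨_, hj⟩).symm
        simpa using this
      refine ⟨y, mem_iInter₂.2 fun β hβ => ?_, ?_⟩
      · have := h.mem_cell (hβ.trans hk) y
        rwa [cell, hyx β hβ] at this
      · rw [node_eq, stepAt_congr hyx]

/-- The runs along a branch of the tree fit together to one legal run. -/
theorem TreeData.legalI_of_branch (h : TreeData κ P Q σ) {l : Ordinal.{u}} (hl : l ≤ κ.ord)
    {b : Ordinal.{u} → X} (hb : ∀ γ β, γ ≤ β → β < l → b β ∈ cell κ P Q σ (b γ) γ)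
    {β : Ordinal.{u}} (hβ : β < l) :
    σ.LegalI (fun γ => play κ P Q σ (b γ) γ) β ∧
      σ.reply (fun γ => play κ P Q σ (b γ) γ) β = σ.reply (play κ P Q σ (b β)) β := by
  have key (γ : Ordinal.{u}) (hγ : γ ≤ β) : play κ P Q σ (b β) γ = play κ P Q σ (b γ) γ :=
    congrArg Prod.fst (h.node_eq_of_mem (hγ.trans_lt (hβ.trans_le hl)) (hb γ β hγ hβ))
  exact ⟨(h.legalI (hβ.trans_le hl) (b β)).congr key,
    Strategy.reply_congr fun γ hγ => (key γ hγ).symm⟩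

/-- In the fair game the closed sets that cut the cells out of player II's answers do no harm on
branches of length `κ`: a point outside of such a closed set is excluded at a later round. -/
theorem TreeData.exists_mem_of_fair (h : TreeData κ P Q σ) (hσ : σ.IsFairWinning κ)
    {b : Ordinal.{u} → X} (hb : ∀ γ β, γ ≤ β → β < κ.ord → b β ∈ cell κ P Q σ (b γ) γ) :
    ∃ z, ∀ β < κ.ord, z ∈ cell κ P Q σ (b β) β := by
  obtain ⟨z, hz⟩ := (hσ _ κ.ord le_rfl fun β hβ => (h.legalI_of_branch le_rfl hb hβ).1).2 rfl
  have hz' (β : Ordinal.{u}) (hβ : β < κ.ord) : z ∈ σ.reply (play κ P Q σ (b β)) β :=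
    (h.legalI_of_branch le_rfl hb hβ).2 ▸ mem_stage.1 hz β hβ
  have hbc (γ β : Ordinal.{u}) (hγ : γ ≤ β) (hβ : β < κ.ord) :
      cell κ P Q σ (b β) γ = cell κ P Q σ (b γ) γ :=
    h.cell_eq_of_mem (hγ.trans_lt hβ) (hb γ β hγ hβ)
  refine ⟨z, fun β => ?_⟩
  induction β using WellFoundedLT.induction with
  | ind β ih =>
  intro hβ
  obtain ⟨F, hF, he⟩ := h.exists_cell_eq hβ (b β)
  rw [he]
  refine ⟨⟨mem_iInter₂.2 fun γ hγ => ?_, hz' β hβ⟩, ?_⟩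
  · rw [hbc γ β hγ.le hβ]
    exact ih γ hγ (hγ.trans hβ)
  · by_contra hzF
    obtain ⟨α, hβα, hα, hzP, hQF⟩ := h.pairing.exists_gt z Fᶜ hF.isOpen_compl hzF β hβ
    rcases h.point_mem_or_disjoint hα (b α) with h1 | h1
    · have := mem_iInter₂.1 (h.point_mem hα (b α)) β hβα
      rw [hbc β α hβα.le hα, he] at this
      exact hQF (h.pairing.subset α h1.1) this.2
    · exact disjoint_left.1 h1 ((h.legalII hα (b α)).2.2 (hz' α hα)) hzP

/-- In an additive space player I may play inside the cells, and so all branches can be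
continued. -/
theorem TreeData.exists_mem_of_additive (h : TreeData κ P Q σ)
    (hadd : IsAdditive κ X) (hσ : σ.IsWinning κ) {l : Ordinal.{u}} (hl : l ≤ κ.ord)
    {b : Ordinal.{u} → X} (hb : ∀ γ β, γ ≤ β → β < l → b β ∈ cell κ P Q σ (b γ) γ) :
    ∃ z, ∀ β < l, z ∈ cell κ P Q σ (b β) β := by
  rcases zero_or_succ_or_isSuccLimit l with rfl | ⟨δ, rfl⟩ | hlim
  · exact ⟨b 0, fun β hβ => absurd hβ not_lt_zero⟩
  · exact ⟨b δ, fun β hβ => hb β δ (Order.lt_succ_iff.1 hβ) (Order.lt_succ δ)⟩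
  · obtain ⟨z, hz⟩ := (hσ _ l hl fun β hβ => (h.legalI_of_branch hl hb hβ).1).2 hlim
    refine ⟨z, fun β hβ => ?_⟩
    have hs := hlim.succ_lt hβ
    have h1 : z ∈ σ.reply (play κ P Q σ (b (Order.succ β))) (Order.succ β) :=
      (h.legalI_of_branch hl hb hs).2 ▸ mem_stage.1 hz _ hs
    have h2 := mem_iInter₂.1 (h.move_subset hadd (hs.trans_le hl) _
      ((h.legalII (hs.trans_le hl) _).2.2 h1)) β (Order.lt_succ β)
    rwa [h.cell_eq_of_mem (hβ.trans_le hl) (hb β _ (Order.le_succ β) hs)] at h2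

end Branches

/-! ### Trees of partitions -/

/-- A tree of height `κ` of partitions of `X`, finer and finer, whose cells separate points from
closed sets. The cells need not be open. -/
structure PartitionTree (κ : Cardinal.{u}) (X : Type u) [TopologicalSpace X] where
  /-- The cell of a point at a level. -/
  cell : κ.ord.ToType → X → Set X
  mem_cell : ∀ k x, x ∈ cell k x
  cell_eq_of_mem : ∀ {k x y}, y ∈ cell k x → cell k y = cell k x
  cell_anti : ∀ {j k}, j ≤ k → ∀ x, cell k x ⊆ cell j x
  exists_cell_subset : ∀ {x O}, IsOpen O → x ∈ O → ∃ k, cell k x ⊆ O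

/-- Every branch through the levels in `I` is the branch of a point. The branch is given by
a choice of points `b k` in its cells. -/
def PartitionTree.CompleteOn {κ : Cardinal.{u}} {X : Type u} [TopologicalSpace X]
    (T : PartitionTree κ X) (I : Set κ.ord.ToType) : Prop :=
  ∀ b : κ.ord.ToType → X, (∀ j ∈ I, ∀ k ∈ I, j ≤ k → T.cell j (b k) = T.cell j (b j)) →
    ∃ z, ∀ k ∈ I, T.cell k z = T.cell k (b k)

section Existence

variable {κ : Cardinal.{u}} {X : Type u} [TopologicalSpace X]

/-- The tree of partitions given by a strategy. -/
noncomputable def TreeData.tree {P Q : Ordinal.{u} → Set X} {σ : Strategy X}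
    (h : TreeData κ P Q σ) : PartitionTree κ X where
  cell k x := GenPolish.cell κ P Q σ x (ToType.toOrd k)
  mem_cell k x := h.mem_cell (ToType.toOrd k).2 x
  cell_eq_of_mem {k _ _} hy := h.cell_eq_of_mem (ToType.toOrd k).2 hy
  cell_anti {_ k} hjk x := h.cell_subset (ToType.toOrd k).2 x (ToType.mk.symm.monotone hjk)
  exists_cell_subset hO hx := by
    obtain ⟨α, hα, h1⟩ := h.exists_cell_subset hO hx
    exact ⟨ToType.mk ⟨α, hα⟩, by simpa using h1⟩

theorem TreeData.completeOn {P Q : Ordinal.{u} → Set X} {σ : Strategy X}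
    (h : TreeData κ P Q σ) {I : Set κ.ord.ToType} (hI : IsLowerSet I)
    (hc : ∀ l ≤ κ.ord, (∀ k, k ∈ I ↔ (ToType.toOrd k : Ordinal.{u}) < l) → ∀ b : Ordinal.{u} → X,
      (∀ γ β, γ ≤ β → β < l → b β ∈ GenPolish.cell κ P Q σ (b γ) γ) →
      ∃ z, ∀ β < l, z ∈ GenPolish.cell κ P Q σ (b β) β) :
    h.tree.CompleteOn I := by
  classical
  intro b hb
  let l : Ordinal.{u} := sInf {o | ∀ k ∈ I, (ToType.toOrd k : Ordinal.{u}) < o}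
  have hlκ : l ≤ κ.ord := csInf_le' fun k _ => (ToType.toOrd k).2
  have hl1 : ∀ k ∈ I, (ToType.toOrd k : Ordinal.{u}) < l :=
    csInf_mem (s := {o | ∀ k ∈ I, (ToType.toOrd k : Ordinal.{u}) < o})
      ⟨κ.ord, fun k _ => (ToType.toOrd k).2⟩
  have hl2 (o : Ordinal.{u}) (ho : o < l) : ToType.mk ⟨o, ho.trans_le hlκ⟩ ∈ I := by
    have := notMem_of_lt_csInf' ho
    simp only [mem_ofPred_eq, not_forall, not_lt] at this
    obtain ⟨k, hk, hok⟩ := this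
    refine hI ?_ hk
    rw [← OrderIso.le_symm_apply]
    exact hok
  have hl3 (k) (hk : (ToType.toOrd k : Ordinal.{u}) < l) : k ∈ I := by
    have e : ToType.mk (ToType.toOrd k) = k := ToType.mk.apply_symm_apply k
    exact e ▸ (hl2 _ hk : ToType.mk (ToType.toOrd k) ∈ I)
  have : Nonempty X := ⟨b (ToType.mk ⟨0, h.isRegular.ord_pos⟩)⟩
  let b' : Ordinal.{u} → X := fun o =>
    if ho : o < κ.ord then b (ToType.mk ⟨o, ho⟩) else Classical.arbitrary X
  have hb' (o : Ordinal.{u}) (ho : o < κ.ord) : b' o = b (ToType.mk ⟨o, ho⟩) := dif_pos ho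
  obtain ⟨z, hz⟩ := hc l hlκ (fun k => ⟨hl1 k, hl3 k⟩) b' fun γ β hγβ hβ => by
    have hβκ := hβ.trans_le hlκ
    have hγκ := hγβ.trans_lt hβκ
    have := hb _ (hl2 γ (hγβ.trans_lt hβ)) _ (hl2 β hβ) (ToType.mk.monotone hγβ)
    rw [hb' β hβκ, hb' γ hγκ]
    have h2 := h.mem_cell hγκ (b (ToType.mk ⟨β, hβκ⟩))
    simp only [TreeData.tree, ToType.toOrd, OrderIso.symm_apply_apply] at this
    rwa [this] at h2
  refine ⟨z, fun k hk => h.cell_eq_of_mem (ToType.toOrd k).2 ?_⟩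
  have := hz _ (hl1 k hk)
  rw [hb' _ (ToType.toOrd k).2] at this
  simpa using this

theorem exists_treeData (hreg : κ.IsRegular) (hunc : ℵ₀ < κ) (hT : T3Space X)
    (hw : WeightLE κ X) {σ : Strategy X} (hσ : σ.Obeys κ) :
    ∃ P Q : Ordinal.{u} → Set X, TreeData κ P Q σ := by
  obtain ⟨P, Q, h1, h2⟩ := hw.exists_pairs hreg
  exact ⟨P, Q, hreg, hunc, inferInstance, hw,
    ⟨fun α => (h1 α).1, fun α => (h1 α).2.1, fun α => (h1 α).2.2, h2⟩, hσ⟩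

theorem IsFSC.exists_partitionTree (hreg : κ.IsRegular) (hunc : ℵ₀ < κ)
    (hpow : (2 : Cardinal.{u}) ^< κ = κ) (hX : IsFSC κ X) :
    ∃ T : PartitionTree κ X, (∀ k x, T.cell k x ∈ Bor κ X) ∧ (∀ k, #(range (T.cell k)) ≤ κ) ∧
      T.CompleteOn univ := by
  obtain ⟨hT, hw, σ, hσ⟩ := hX
  obtain ⟨P, Q, h⟩ := exists_treeData hreg hunc hT hw fun p γ hγ hp => (hσ p γ hγ hp).1
  refine ⟨h.tree, fun k x => h.cell_mem_bor (ToType.toOrd k).2 x, fun k => ?_,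
    h.completeOn isLowerSet_univ fun l hl hI b hb => ?_⟩
  · refine le_trans ?_ (h.mk_range_node_le hpow k)
    refine (mk_le_mk_of_subset ?_).trans (mk_image_le (f := Prod.snd))
    rintro _ ⟨x, rfl⟩
    exact ⟨_, ⟨x, rfl⟩, rfl⟩
  · obtain rfl : l = κ.ord := by
      refine hl.eq_of_not_lt fun hlt => ?_
      simpa using (hI (ToType.mk ⟨l, hlt⟩)).1 (mem_univ _)
    exact h.exists_mem_of_fair hσ hb

theorem IsAdditiveSC.exists_partitionTree (hreg : κ.IsRegular) (hunc : ℵ₀ < κ)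
    (hX : IsAdditiveSC κ X) :
    ∃ T : PartitionTree κ X, (∀ k x, IsOpen (T.cell k x)) ∧
      ∀ I, IsLowerSet I → T.CompleteOn I := by
  obtain ⟨hadd, hT, hw, σ, hσ⟩ := hX
  obtain ⟨P, Q, h⟩ := exists_treeData hreg hunc hT hw fun p γ hγ hp => (hσ p γ hγ hp).1
  exact ⟨h.tree, fun k x => h.isOpen_cell hadd (ToType.toOrd k).2 x,
    fun I hI => h.completeOn hI fun l hl _ b hb => h.exists_mem_of_additive hadd hσ hl hb⟩

end Existence

/-! ### Strategies that depend on the last move only -/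

section Memoryless

variable {κ : Cardinal.{u}} {X : Type u} [TopologicalSpace X]

theorem Strategy.LegalI.subset_reply {σ : Strategy X} {p : Ordinal.{u} → Set X × X}
    {α β : Ordinal.{u}} (hp : σ.LegalI p β) (hαβ : α < β) : (p β).1 ⊆ σ.reply p α := by
  obtain ⟨⟨O, -, hU⟩, -⟩ := hp
  rw [hU]
  exact inter_subset_left.trans (iInter₂_subset α hαβ)

/-- The strategy of player II that looks at the number of the round and at the last move of
player I only. -/
def memoryless (f : Ordinal.{u} → Set X × X → Set X) : Strategy X :=
  fun α m => f α (m ⟨α, self_mem_Iic⟩)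

/-- In an additive space all the sets played are open, so that a choice of open sets
`f α (U, x)` with `x ∈ f α (U, x) ⊆ U` is a strategy. -/
theorem IsAdditive.memoryless_legal (hadd : IsAdditive κ X)
    {f : Ordinal.{u} → Set X × X → Set X}
    (hf : ∀ α U x, IsOpen U → x ∈ U → IsOpen (f α (U, x)) ∧ x ∈ f α (U, x) ∧ f α (U, x) ⊆ U)
    {p : Ordinal.{u} → Set X × X} {γ : Ordinal.{u}} (hγ : γ ≤ κ.ord)
    (hp : ∀ α < γ, (memoryless f).LegalI p α) {α : Ordinal.{u}} (hα : α < γ) :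
    (memoryless f).LegalII p α ∧ IsOpen (p α).1 := by
  have key : IsOpen (p α).1 ∧ IsOpen ((memoryless f).reply p α) := by
    induction α using WellFoundedLT.induction with
    | ind α ih =>
    obtain ⟨⟨O, hO, hU⟩, hx⟩ := hp α hα
    have : IsOpen (p α).1 := by
      rw [hU]
      exact (hadd.isOpen_biInter_lt (hα.trans_le hγ) fun β hβ => (ih β hβ (hβ.trans hα)).2).inter hO
    exact ⟨this, (hf α _ _ this hx).1⟩
  obtain ⟨hV, hxV, hVU⟩ := hf α _ _ key.1 (hp α hα).2
  obtain ⟨⟨O, -, hU⟩, -⟩ := hp α hα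
  exact ⟨⟨⟨_, hV, (inter_eq_right.2 (hVU.trans (hU ▸ inter_subset_left))).symm⟩, hxV, hVU⟩, key.1⟩

/-- Player II wins by playing sets from a basis in which decreasing sequences have nonempty
intersections. -/
theorem IsAdditive.exists_isWinning (hadd : IsAdditive κ X) {𝓑 : Set (Set X)}
    (h𝓑 : TopologicalSpace.IsTopologicalBasis 𝓑)
    (hne : ∀ l : Ordinal.{u}, 0 < l → ∀ V : Ordinal.{u} → Set X,
      (∀ i < l, V i ∈ 𝓑 ∧ (V i).Nonempty) → (∀ i j, i ≤ j → j < l → V j ⊆ V i) →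
      (⋂ i < l, V i).Nonempty) :
    ∃ σ : Strategy X, σ.IsWinning κ := by
  have hf (m : Set X × X) : ∃ V, IsOpen m.1 → m.2 ∈ m.1 → V ∈ 𝓑 ∧ m.2 ∈ V ∧ V ⊆ m.1 := by
    by_cases h : IsOpen m.1 ∧ m.2 ∈ m.1
    · obtain ⟨V, hV⟩ := h𝓑.exists_subset_of_mem_open h.2 h.1
      exact ⟨V, fun _ _ => hV⟩
    · exact ⟨∅, fun h1 h2 => absurd ⟨h1, h2⟩ h⟩
  choose f hf using hf
  have hf' (α : Ordinal.{u}) (U : Set X) (x : X) (hU : IsOpen U) (hx : x ∈ U) :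
      IsOpen (f (U, x)) ∧ x ∈ f (U, x) ∧ f (U, x) ⊆ U :=
    ⟨h𝓑.isOpen (hf _ hU hx).1, (hf _ hU hx).2⟩
  refine ⟨memoryless fun _ => f, fun p γ hγ hp =>
    ⟨fun α hα => (hadd.memoryless_legal hf' hγ hp hα).1, fun hlim => ?_⟩⟩
  refine hne γ hlim.bot_lt (fun α => f (p α)) (fun i hi => ?_) fun i j hij hj => ?_
  · have := hf (p i) (hadd.memoryless_legal hf' hγ hp hi).2 (hp i hi).2
    exact ⟨this.1, _, this.2.1⟩
  · rcases hij.lt_or_eq with hij | rfl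
    · exact (hadd.memoryless_legal hf' hγ hp hj).1.2.2.trans
        ((hp j hj).subset_reply hij)
    · rfl

end Memoryless

/-! ### Metrics with values in an ordered group -/

section Degree

variable {κ : Cardinal.{u}} {G : Type u} [AddCommGroup G] [LinearOrder G]

theorem exists_pos_forall_lt (hG : degree G = κ) {S : Set G} (hS : #S < κ) (hpos : ∀ s ∈ S, 0 < s) :
    ∃ ε, 0 < ε ∧ ∀ s ∈ S, ε < s := by
  by_contra! h
  let S' : Set {g : G // 0 < g}ᵒᵈ := range fun s : S => OrderDual.toDual ⟨s.1, hpos s s.2⟩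
  have hc : IsCofinal S' := fun ε => by
    obtain ⟨s, hs, hle⟩ := h ε.ofDual.1 ε.ofDual.2
    exact ⟨_, ⟨⟨s, hs⟩, rfl⟩, hle⟩
  have := (Order.cof_le hc).trans mk_range_le
  exact (hG.symm.le.trans this).not_gt hS

theorem exists_pos (hreg : κ.IsRegular) (hG : degree G = κ) : ∃ r : G, 0 < r := by
  obtain ⟨r, hr, -⟩ := exists_pos_forall_lt hG (S := ∅) (by simpa using hreg.pos) (by simp)
  exact ⟨r, hr⟩

/-- A group of degree `κ` has a strictly decreasing coinitial sequence of length `κ` of positive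
elements. -/
theorem exists_strictAnti (hreg : κ.IsRegular) (hG : degree G = κ) :
    ∃ ε : κ.ord.ToType → G, (∀ k, 0 < ε k) ∧ StrictAnti ε ∧ ∀ r, 0 < r → ∃ k, ε k < r := by
  obtain ⟨s, hs, hc⟩ := Order.exists_cof_eq {g : G // 0 < g}ᵒᵈ
  have hc' : #s = #κ.ord.ToType := by rw [mk_ord_toType]; exact hc.trans hG
  obtain ⟨e⟩ := Cardinal.eq.1 hc'
  have hex (k : κ.ord.ToType) (ih : ∀ j, j < k → {g : G // 0 < g}) :
      ∃ g : {g : G // 0 < g}, g.1 < (e.symm k).1.ofDual.1 ∧ ∀ j hj, g.1 < (ih j hj).1 := by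
    obtain ⟨g, hg, hlt⟩ := exists_pos_forall_lt (κ := κ) hG
      (S := insert (e.symm k).1.ofDual.1 (range fun j : Iio k => (ih j.1 j.2).1))
      (mk_insert_le.trans_lt (add_lt_of_lt hreg.aleph0_le
        (mk_range_le.trans_lt (mk_Iio_lt_self k)) (one_lt_aleph0.trans_le hreg.aleph0_le)))
      (by
        rintro _ (rfl | ⟨j, rfl⟩)
        exacts [(e.symm k).1.ofDual.2, (ih j.1 j.2).2])
    exact ⟨⟨g, hg⟩, hlt _ (mem_insert _ _), fun j hj =>
      hlt _ (mem_insert_of_mem _ ⟨⟨j, hj⟩, rfl⟩)⟩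
  choose f hf1 hf2 using hex
  let ε : κ.ord.ToType → {g : G // 0 < g} := (wellFounded_lt).fix f
  have hε (k) : ε k = f k fun j _ => ε j := WellFounded.fix_eq _ _ _
  refine ⟨fun k => (ε k).1, fun k => (ε k).2, fun j k hjk => ?_, fun r hr => ?_⟩
  · change (ε k).1 < _
    rw [hε k]
    exact hf2 _ _ j hjk
  · obtain ⟨t, ht, hrt⟩ := hs (OrderDual.toDual ⟨r, hr⟩)
    refine ⟨e ⟨t, ht⟩, ?_⟩
    change (ε _).1 < _
    rw [hε]
    refine (hf1 _ _).trans_le ?_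
    rw [Equiv.symm_apply_apply]
    exact hrt

end Degree

section Metric

variable {κ : Cardinal.{u}} {G : Type u} [AddCommGroup G] [LinearOrder G] {X : Type u}

theorem GMetric.mem_ball_self (d : GMetric G X) (x : X) {r : G} (hr : 0 < r) : x ∈ d.ball x r := by
  change d.dist x x < r
  rwa [(d.dist_eq_zero_iff x x).2 rfl]

theorem GMetric.ball_mono (d : GMetric G X) (x : X) {r s : G} (h : r ≤ s) :
    d.ball x r ⊆ d.ball x s := fun _ hy => lt_of_lt_of_le hy h

theorem IsSphericallyCompleteGPolish.isGPolish [TopologicalSpace X]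
    (hX : IsSphericallyCompleteGPolish κ G X) :
    IsGPolish κ G X := by
  obtain ⟨hT, hw, d, hd, hc, -⟩ := hX
  exact ⟨hT, hw, d, hd, hc⟩

variable [IsOrderedAddMonoid G]

theorem GMetric.exists_ball_subset_ball (d : GMetric G X) {x y : X} {r : G} (hy : y ∈ d.ball x r) :
    ∃ s, 0 < s ∧ d.ball y s ⊆ d.ball x r :=
  ⟨r - d.dist x y, sub_pos.2 hy, fun z hz =>
    (d.dist_triangle x y z).trans_lt (lt_sub_iff_add_lt'.1 hz)⟩

variable [TopologicalSpace X]

theorem GMetric.Compatible.isTopologicalBasis {d : GMetric G X} (hd : d.Compatible)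
    (hpos : ∃ r : G, 0 < r) :
    TopologicalSpace.IsTopologicalBasis {B | ∃ (x : X) (ε : G), 0 < ε ∧ B = d.ball x ε} := by
  refine ⟨?_, ?_, hd⟩
  · rintro _ ⟨x, r, hr, rfl⟩ _ ⟨y, s, hs, rfl⟩ z ⟨hzx, hzy⟩
    obtain ⟨r', hr', h1⟩ := d.exists_ball_subset_ball hzx
    obtain ⟨s', hs', h2⟩ := d.exists_ball_subset_ball hzy
    exact ⟨_, ⟨z, min r' s', lt_min hr' hs', rfl⟩, d.mem_ball_self z (lt_min hr' hs'),
      subset_inter ((d.ball_mono z (min_le_left _ _)).trans h1)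
        ((d.ball_mono z (min_le_right _ _)).trans h2)⟩
  · obtain ⟨r, hr⟩ := hpos
    exact eq_univ_of_forall fun x => ⟨_, ⟨x, r, hr, rfl⟩, d.mem_ball_self x hr⟩

theorem GMetric.Compatible.isOpen_ball {d : GMetric G X} (hd : d.Compatible) (x : X) {r : G}
    (hr : 0 < r) : IsOpen (d.ball x r) :=
  (hd.isTopologicalBasis ⟨r, hr⟩).isOpen ⟨x, r, hr, rfl⟩

theorem GMetric.Compatible.exists_ball_subset {d : GMetric G X} (hd : d.Compatible)
    (hpos : ∃ r : G, 0 < r) {U : Set X} (hU : IsOpen U) {x : X} (hx : x ∈ U) :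
    ∃ r, 0 < r ∧ d.ball x r ⊆ U := by
  obtain ⟨_, ⟨y, r, hr, rfl⟩, hxB, hBU⟩ :=
    (hd.isTopologicalBasis hpos).exists_subset_of_mem_open hx hU
  obtain ⟨s, hs, hsr⟩ := d.exists_ball_subset_ball hxB
  exact ⟨s, hs, hsr.trans hBU⟩

theorem exists_add_self_le (hunc : ℵ₀ < κ) (hG : degree G = κ) {r : G} (hr : 0 < r) :
    ∃ s, 0 < s ∧ s + s ≤ r := by
  obtain ⟨t, ht, htr⟩ := exists_pos_forall_lt hG (S := {r})
    (by simpa using one_lt_aleph0.trans hunc) (by simpa using hr)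
  have htr := htr r rfl
  refine ⟨min t (r - t), lt_min ht (sub_pos.2 htr), ?_⟩
  calc min t (r - t) + min t (r - t) ≤ t + (r - t) :=
        add_le_add (min_le_left _ _) (min_le_right _ _)
    _ = r := add_sub_cancel t r

theorem GMetric.Compatible.isAdditive (hreg : κ.IsRegular) (hG : degree G = κ) {d : GMetric G X}
    (hd : d.Compatible) : IsAdditive κ X := by
  have hpos := exists_pos hreg hG
  intro S hS hSo
  rw [isOpen_iff_forall_mem_open]
  intro x hx
  have h (U : S) : ∃ r, 0 < r ∧ d.ball x r ⊆ U :=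
    hd.exists_ball_subset hpos (hSo U U.2) (hx U U.2)
  choose r hr hrU using h
  obtain ⟨ε, hε, hlt⟩ := exists_pos_forall_lt hG (mk_range_le.trans_lt hS : #(range r) < κ)
    (by rintro _ ⟨U, rfl⟩; exact hr U)
  exact ⟨d.ball x ε, fun y hy U hU => hrU ⟨U, hU⟩ (d.ball_mono x (hlt _ ⟨⟨U, hU⟩, rfl⟩).le hy),
    hd.isOpen_ball x hε, d.mem_ball_self x hε⟩

theorem IsSphericallyCompleteGPolish.isAdditiveSC (hreg : κ.IsRegular) (hG : degree G = κ)
    (hX : IsSphericallyCompleteGPolish κ G X) : IsAdditiveSC κ X := by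
  obtain ⟨hT, hw, d, hd, -, hs⟩ := hX
  have hadd := hd.isAdditive hreg hG
  refine ⟨hadd, hT, hw, hadd.exists_isWinning (hd.isTopologicalBasis (exists_pos hreg hG))
    fun l hl V hV hanti => ?_⟩
  have h (i : Iio l) : ∃ x r, 0 < r ∧ V i = d.ball x r := (hV i i.2).1
  choose x r hr hVx using h
  obtain ⟨z, hz⟩ := hs l hl x r hr fun i j hij => by
    rw [← hVx, ← hVx]
    exact hanti i j hij j.2
  refine ⟨z, mem_iInter₂.2 fun i hi => ?_⟩
  have := mem_iInter.1 hz ⟨i, hi⟩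
  rwa [← hVx] at this

/-- In a `G`-Polish space player II wins the fair game by shrinking the diameters to `0` and
keeping the closure of his set inside the set just played: the points played by player I form
a Cauchy sequence, and its limit belongs to all the sets. -/
theorem IsGPolish.isFSC (hreg : κ.IsRegular) (hunc : ℵ₀ < κ) (hG : degree G = κ)
    (hX : IsGPolish κ G X) : IsFSC κ X := by
  obtain ⟨hT, hw, d, hd, hc⟩ := hX
  have hpos := exists_pos hreg hG
  have hadd := hd.isAdditive hreg hG
  obtain ⟨ε, hε, -, hεr⟩ := exists_strictAnti hreg hG
  have hf (α : Ordinal.{u}) (m : Set X × X) : ∃ V, IsOpen m.1 → m.2 ∈ m.1 →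
      IsOpen V ∧ m.2 ∈ V ∧ closure V ⊆ m.1 ∧
        ∀ h : α < κ.ord, V ⊆ d.ball m.2 (ε (ToType.mk ⟨α, h⟩)) := by
    by_cases h : IsOpen m.1 ∧ m.2 ∈ m.1
    · obtain ⟨C, hC, hCc, hCm⟩ := exists_mem_nhds_isClosed_subset (h.1.mem_nhds h.2)
      have hcl : closure (interior C) ⊆ m.1 := (closure_minimal interior_subset hCc).trans hCm
      have hmem : m.2 ∈ interior C := mem_interior_iff_mem_nhds.2 hC
      by_cases hα : α < κ.ord
      · refine ⟨interior C ∩ d.ball m.2 (ε (ToType.mk ⟨α, hα⟩)), fun _ _ =>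
          ⟨isOpen_interior.inter (hd.isOpen_ball _ (hε _)), ⟨hmem, d.mem_ball_self _ (hε _)⟩,
            (closure_mono inter_subset_left).trans hcl, fun _ => inter_subset_right⟩⟩
      · exact ⟨interior C, fun _ _ => ⟨isOpen_interior, hmem, hcl, fun h => absurd h hα⟩⟩
    · exact ⟨∅, fun h1 h2 => absurd ⟨h1, h2⟩ h⟩
  choose f hf using hf
  have hf' (α : Ordinal.{u}) (U : Set X) (x : X) (hU : IsOpen U) (hx : x ∈ U) :
      IsOpen (f α (U, x)) ∧ x ∈ f α (U, x) ∧ f α (U, x) ⊆ U :=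
    ⟨(hf α _ hU hx).1, (hf α _ hU hx).2.1, subset_closure.trans (hf α _ hU hx).2.2.1⟩
  refine ⟨hT, hw, memoryless f, fun p γ hγ hp =>
    ⟨fun α hα => (hadd.memoryless_legal hf' hγ hp hα).1, ?_⟩⟩
  rintro rfl
  have hsucc {α : Ordinal.{u}} (hα : α < κ.ord) : Order.succ α < κ.ord :=
    (isSuccLimit_ord hunc.le).succ_lt hα
  have hmem {α β : Ordinal.{u}} (hαβ : α ≤ β) (hβ : β < κ.ord) : (p β).2 ∈ f α (p α) := by
    rcases hαβ.lt_or_eq with h | rfl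
    · exact (hp β hβ).subset_reply h (hp β hβ).2
    · exact (hadd.memoryless_legal hf' le_rfl hp hβ).1.2.1
  have hspec {α : Ordinal.{u}} (hα : α < κ.ord) :=
    hf α (p α) (hadd.memoryless_legal hf' le_rfl hp hα).2 (hp α hα).2
  obtain ⟨y, hy⟩ := hc (fun i => (p i).2) fun r hr => by
    obtain ⟨s, hs, hsr⟩ := exists_add_self_le hunc hG hr
    obtain ⟨k, hk⟩ := hεr s hs
    refine ⟨ToType.toOrd k, fun β γ hβ hγ => ?_⟩
    have hkk : f (ToType.toOrd k) (p (ToType.toOrd k)) ⊆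
        d.ball (p (ToType.toOrd k)).2 s := by
      refine ((hspec (ToType.toOrd k).2).2.2.2 (ToType.toOrd k).2).trans (d.ball_mono _ ?_)
      have : ToType.mk (ToType.toOrd k) = k := ToType.mk.apply_symm_apply k
      exact this.symm ▸ hk.le
    have h1 : d.dist _ _ < s := hkk (hmem hβ β.2)
    have h2 : d.dist _ _ < s := hkk (hmem hγ γ.2)
    calc d.dist (p β).2 (p γ).2 ≤ _ := d.dist_triangle _ (p (ToType.toOrd k)).2 _
      _ < s + s := by
        rw [d.dist_comm]
        exact add_lt_add h1 h2
      _ ≤ r := hsr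
  refine ⟨y, mem_stage.2 fun α hα => ?_⟩
  refine (hp _ (hsucc hα)).subset_reply (Order.lt_succ α) ?_
  refine (hspec (hsucc hα)).2.2.1 (mem_closure_iff.2 fun O hO hyO => ?_)
  obtain ⟨r, hr, hrO⟩ := hd.exists_ball_subset hpos hO hyO
  obtain ⟨δ, hδ⟩ := hy r hr
  let β : Iio κ.ord := max δ ⟨Order.succ α, hsucc hα⟩
  refine ⟨(p β).2, hrO ?_, hmem (le_max_right δ ⟨Order.succ α, hsucc hα⟩) β.2⟩
  change d.dist _ _ < r
  rw [d.dist_comm]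
  exact hδ β (le_max_left _ _)

end Metric

/-! ### The ultrametric of a tree of partitions -/

namespace PartitionTree

variable {κ : Cardinal.{u}} {X : Type u} [TopologicalSpace X] (T : PartitionTree κ X)

theorem mem_cell_iff {k : κ.ord.ToType} {x y : X} :
    y ∈ T.cell k x ↔ T.cell k x = T.cell k y :=
  ⟨fun h => (T.cell_eq_of_mem h).symm, fun h => h ▸ T.mem_cell k y⟩

theorem cell_eq_of_le {j k : κ.ord.ToType} (hjk : j ≤ k) {x y : X}
    (h : T.cell k x = T.cell k y) : T.cell j x = T.cell j y :=
  T.mem_cell_iff.1 (T.cell_anti hjk x (T.mem_cell_iff.2 h))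

theorem exists_cell_ne [T1Space X] {x y : X} (h : x ≠ y) : ∃ k, T.cell k x ≠ T.cell k y := by
  obtain ⟨k, hk⟩ := T.exists_cell_subset (isOpen_compl_singleton (x := y)) h
  exact ⟨k, fun he => hk (T.mem_cell_iff.2 he) rfl⟩

section Metric

variable {G : Type u} [AddCommGroup G] [LinearOrder G]

open Classical in
/-- The value of `ε` at the least element of a set of levels, and `0` if the set is empty. -/
noncomputable def firstValue (ε : κ.ord.ToType → G) (S : Set κ.ord.ToType) : G :=
  if h : S.Nonempty then ε (wellFounded_lt.min S h) else 0

theorem firstValue_nonneg {ε : κ.ord.ToType → G} (hε : ∀ k, 0 < ε k) (S : Set κ.ord.ToType) :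
    0 ≤ firstValue ε S := by
  unfold firstValue
  split_ifs
  exacts [(hε _).le, le_rfl]

theorem firstValue_lt_iff {ε : κ.ord.ToType → G} (hanti : StrictAnti ε) (S : Set κ.ord.ToType)
    {r : G} (hr : 0 < r) : firstValue ε S < r ↔ ∀ k, r ≤ ε k → k ∉ S := by
  unfold firstValue
  split_ifs with h
  · refine ⟨fun hlt k hk hkS => ?_, fun hS => ?_⟩
    · exact wellFounded_lt.not_lt_min S hkS (hanti.lt_iff_gt.1 (hlt.trans_le hk))
    · by_contra! hle
      exact hS _ hle (wellFounded_lt.min_mem S h)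
  · exact ⟨fun _ k _ hkS => h ⟨k, hkS⟩, fun _ => hr⟩

variable [IsOrderedAddMonoid G]

/-- The ultrametric of a tree of partitions: the distance of `x` and `y` is `ε k` for the first
level `k` at which `x` and `y` are in different cells. -/
noncomputable def metric [T1Space X] {ε : κ.ord.ToType → G} (hε : ∀ k, 0 < ε k)
    (hanti : StrictAnti ε) : GMetric G X where
  dist x y := firstValue ε {k | T.cell k x ≠ T.cell k y}
  dist_nonneg x y := firstValue_nonneg hε _
  dist_eq_zero_iff x y := by
    refine ⟨fun h => ?_, ?_⟩
    · by_contra hxy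
      have hne : {k | T.cell k x ≠ T.cell k y}.Nonempty := T.exists_cell_ne hxy
      rw [firstValue, dif_pos hne] at h
      exact (hε _).ne' h
    · rintro rfl
      simp [firstValue]
  dist_comm x y := by simp only [ne_comm]
  dist_triangle x y z := by
    by_contra! h
    have h1 := firstValue_nonneg hε {k | T.cell k x ≠ T.cell k y}
    have h2 := firstValue_nonneg hε {k | T.cell k y ≠ T.cell k z}
    have hr := (add_nonneg h1 h2).trans_lt h
    have hxy := (firstValue_lt_iff hanti _ hr).1 ((le_add_of_nonneg_right h2).trans_lt h)
    have hyz := (firstValue_lt_iff hanti _ hr).1 ((le_add_of_nonneg_left h1).trans_lt h)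
    refine lt_irrefl _ ((firstValue_lt_iff hanti _ hr).2 fun k hk hne => hne ?_)
    exact (not_not.1 (hxy k hk)).trans (not_not.1 (hyz k hk))

variable [T1Space X] {ε : κ.ord.ToType → G} (hε : ∀ k, 0 < ε k) (hanti : StrictAnti ε)

theorem dist_metric_lt_iff {x y : X} {r : G} (hr : 0 < r) :
    (T.metric hε hanti).dist x y < r ↔ ∀ k, r ≤ ε k → T.cell k x = T.cell k y := by
  refine (firstValue_lt_iff hanti _ hr).trans (forall₂_congr fun k _ => ?_)
  exact not_not

theorem ball_metric {x : X} {r : G} (hr : 0 < r) :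
    (T.metric hε hanti).ball x r = ⋂ k : {k // r ≤ ε k}, T.cell k x := by
  ext y
  simp only [mem_iInter, Subtype.forall, T.mem_cell_iff]
  exact T.dist_metric_lt_iff hε hanti hr

theorem compatible_metric (hadd : IsAdditive κ X) (hopen : ∀ k x, IsOpen (T.cell k x))
    (hεr : ∀ r, 0 < r → ∃ k, ε k < r) : (T.metric hε hanti).Compatible := by
  refine (TopologicalSpace.isTopologicalBasis_of_isOpen_of_nhds ?_ ?_).eq_generateFrom
  · rintro _ ⟨x, r, hr, rfl⟩
    rw [ball_metric _ _ _ hr]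
    obtain ⟨k₀, hk₀⟩ := hεr r hr
    refine hadd.isOpen_iInter ?_ fun k => hopen _ _
    refine (mk_le_mk_of_subset fun k hk => ?_ : #{k | r ≤ ε k} ≤ #(Iio k₀)).trans_lt
      (mk_Iio_lt_self _)
    exact hanti.lt_iff_gt.1 (hk₀.trans_le hk)
  · intro x O hx hO
    obtain ⟨k, hk⟩ := T.exists_cell_subset hO hx
    refine ⟨_, ⟨x, ε k, hε k, rfl⟩, GMetric.mem_ball_self _ _ (hε k), ?_⟩
    rw [ball_metric _ _ _ (hε k)]
    exact (iInter_subset _ ⟨k, le_rfl⟩).trans hk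

theorem cauchyComplete_metric (hT : T.CompleteOn univ) (hεr : ∀ r, 0 < r → ∃ k, ε k < r) :
    (T.metric hε hanti).CauchyComplete κ := by
  intro x hx
  choose α hα using fun k => hx (ε k) (hε k)
  have hcell {k : κ.ord.ToType} {β γ : Iio κ.ord} (hβ : α k ≤ β) (hγ : α k ≤ γ) :
      T.cell k (x β) = T.cell k (x γ) :=
    (T.dist_metric_lt_iff hε hanti (hε k)).1 (hα k β γ hβ hγ) k le_rfl
  obtain ⟨z, hz⟩ := hT (fun k => x (α k)) fun j _ k _ hjk => by
    have h1 := T.cell_eq_of_le hjk (hcell (le_refl (α k)) (le_max_right (α j) (α k)))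
    exact h1.trans (hcell (le_max_left _ _) le_rfl)
  refine ⟨z, fun r hr => ?_⟩
  obtain ⟨k, hk⟩ := hεr r hr
  refine ⟨α k, fun β hβ => (T.dist_metric_lt_iff hε hanti hr).2 fun j hj => ?_⟩
  refine T.cell_eq_of_le (hanti.lt_iff_gt.1 (hk.trans_le hj)).le ?_
  exact (hcell hβ le_rfl).trans (hz k (mem_univ _)).symm

/-- A decreasing sequence of balls determines a branch through the levels `k` at which one of the
radii is at most `ε k`. -/
theorem sphericallyComplete_metric (hT : ∀ I, IsLowerSet I → T.CompleteOn I) :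
    (T.metric hε hanti).SphericallyComplete := by
  classical
  intro l hl x r hr hball
  have hle {i j : Iio l} (hij : i ≤ j) {k : κ.ord.ToType} (hi : r i ≤ ε k) :
      T.cell k (x i) = T.cell k (x j) :=
    (T.dist_metric_lt_iff hε hanti (hr i)).1
      (hball i j hij (GMetric.mem_ball_self _ _ (hr j))) k hi
  have hcell {i j : Iio l} {k : κ.ord.ToType} (hi : r i ≤ ε k) (hj : r j ≤ ε k) :
      T.cell k (x i) = T.cell k (x j) := by
    rcases le_total i j with h | h
    exacts [hle h hi, (hle h hj).symm]
  let b : κ.ord.ToType → X := fun k =>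
    if h : ∃ i, r i ≤ ε k then x h.choose else x ⟨0, hl⟩
  have hb {k : κ.ord.ToType} (h : ∃ i, r i ≤ ε k) : ∃ i, r i ≤ ε k ∧ b k = x i :=
    ⟨h.choose, h.choose_spec, dif_pos h⟩
  obtain ⟨z, hz⟩ := hT {k | ∃ i, r i ≤ ε k}
    (fun k j hjk ⟨i, hi⟩ => ⟨i, hi.trans (hanti.antitone hjk)⟩) b fun j hj k hk hjk => by
      obtain ⟨i, hi, hbi⟩ := hb hj
      obtain ⟨i', hi', hbi'⟩ := hb hk
      rw [hbi, hbi']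
      exact hcell (hi'.trans (hanti.antitone hjk)) hi
  refine ⟨z, mem_iInter.2 fun i => (T.dist_metric_lt_iff hε hanti (hr i)).2 fun k hk => ?_⟩
  obtain ⟨i', hi', hbi'⟩ := hb ⟨i, hk⟩
  rw [hz k ⟨i, hk⟩, hbi']
  exact hcell hk hi'

end Metric

end PartitionTree

theorem IsAdditiveSC.isSphericallyCompleteGPolish {κ : Cardinal.{u}} {X : Type u}
    [TopologicalSpace X] {G : Type u} [AddCommGroup G] [LinearOrder G] [IsOrderedAddMonoid G]
    (hreg : κ.IsRegular) (hunc : ℵ₀ < κ) (hG : degree G = κ) (hX : IsAdditiveSC κ X) :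
    IsSphericallyCompleteGPolish κ G X := by
  obtain ⟨T, hopen, hT⟩ := hX.exists_partitionTree hreg hunc
  obtain ⟨ε, hε, hanti, hεr⟩ := exists_strictAnti hreg hG
  obtain ⟨hadd, hT3, hw, -⟩ := hX
  exact ⟨hT3, hw, T.metric hε hanti, T.compatible_metric hε hanti hadd hopen hεr,
    T.cauchyComplete_metric hε hanti (hT _ isLowerSet_univ) hεr,
    T.sphericallyComplete_metric hε hanti hT⟩


/-! ### Completing the tree by its dead ends -/

namespace PartitionTree

variable {κ : Cardinal.{u}} {X : Type u} [TopologicalSpace X] (T : PartitionTree κ X)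

/-- The branches of the tree, among which are those that end at a level `k < κ` because the
intersection of their cells is empty; such a branch is continued by the empty set. The branches
of full length are those without the value `∅`. -/
def Branches : Type u :=
  {y : κ.ord.ToType → Set X // (∀ k, y k = ∅ ∨ y k ∈ range (T.cell k)) ∧
    (∀ j k, j ≤ k → y k ⊆ y j) ∧ ∀ k, y k = ∅ → ⋂ j < k, y j = ∅}

variable {T}

/-- The branches that agree with `y` up to the level `k`. -/
def Branches.nbhd (k : κ.ord.ToType) (y : T.Branches) : Set T.Branches :=
  {z | ∀ j ≤ k, z.1 j = y.1 j}

theorem Branches.mem_nbhd (k : κ.ord.ToType) (y : T.Branches) : y ∈ nbhd k y := fun _ _ => rfl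

theorem Branches.nbhd_subset {j k : κ.ord.ToType} (hjk : j ≤ k) {y z : T.Branches}
    (hz : z ∈ nbhd j y) : nbhd k z ⊆ nbhd j y :=
  fun _ hw i hi => (hw i (hi.trans hjk)).trans (hz i hi)

/-- The bounded topology: basic open sets are given by the values up to some level. -/
instance : TopologicalSpace T.Branches :=
  TopologicalSpace.generateFrom {U | ∃ k y, U = Branches.nbhd k y}

theorem Branches.isTopologicalBasis (hreg : κ.IsRegular) :
    TopologicalSpace.IsTopologicalBasis {U : Set T.Branches | ∃ k y, U = nbhd k y} := by
  refine ⟨?_, ?_, rfl⟩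
  · rintro _ ⟨j, y, rfl⟩ _ ⟨k, y', rfl⟩ z ⟨hz, hz'⟩
    exact ⟨_, ⟨max j k, z, rfl⟩, mem_nbhd _ _,
      subset_inter (nbhd_subset (le_max_left _ _) hz) (nbhd_subset (le_max_right _ _) hz')⟩
  · obtain ⟨k⟩ : Nonempty κ.ord.ToType := Cardinal.nonempty_ord_toType hreg.pos.ne'
    exact eq_univ_of_forall fun y => ⟨_, ⟨k, y, rfl⟩, mem_nbhd k y⟩

theorem Branches.exists_nbhd_subset (hreg : κ.IsRegular) {O : Set T.Branches} (hO : IsOpen O)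
    {y : T.Branches} (hy : y ∈ O) : ∃ k, nbhd k y ⊆ O := by
  obtain ⟨_, ⟨k, z, rfl⟩, hyz, hzO⟩ := (isTopologicalBasis hreg).exists_subset_of_mem_open hy hO
  exact ⟨k, (nbhd_subset le_rfl hyz).trans hzO⟩

theorem Branches.isOpen_nbhd (k : κ.ord.ToType) (y : T.Branches) : IsOpen (nbhd k y) :=
  TopologicalSpace.isOpen_generateFrom_of_mem ⟨k, y, rfl⟩

theorem Branches.isClosed_nbhd (k : κ.ord.ToType) (y : T.Branches) : IsClosed (nbhd k y) := by
  refine ⟨isOpen_iff_forall_mem_open.2 fun z hz => ⟨nbhd k z, fun w hw hwy => hz fun j hj => ?_,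
    isOpen_nbhd k z, mem_nbhd k z⟩⟩
  exact (hw j hj).symm.trans (hwy j hj)

theorem Branches.t3Space (hreg : κ.IsRegular) : T3Space T.Branches := by
  have : T0Space T.Branches := by
    refine (t0Space_iff_inseparable _).2 fun y z h => Subtype.ext (funext fun k => ?_)
    exact ((h.mem_open_iff (isOpen_nbhd k z)).2 (mem_nbhd k z)) k le_rfl
  have : RegularSpace T.Branches := by
    refine RegularSpace.of_exists_mem_nhds_isClosed_subset fun y U hU => ?_
    obtain ⟨O, hOU, hO, hyO⟩ := mem_nhds_iff.1 hU
    obtain ⟨k, hk⟩ := exists_nbhd_subset hreg hO hyO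
    exact ⟨_, (isOpen_nbhd k y).mem_nhds (mem_nbhd k y), isClosed_nbhd k y, hk.trans hOU⟩
  exact {}

theorem Branches.isAdditive (hreg : κ.IsRegular) : IsAdditive κ T.Branches := by
  intro S hS hSo
  rw [isOpen_iff_forall_mem_open]
  intro y hy
  choose k hk using fun U : S => exists_nbhd_subset hreg (hSo U U.2) (hy U U.2)
  obtain ⟨l, hl⟩ := exists_forall_lt_of_mk_lt hreg hS k
  exact ⟨nbhd l y, fun z hz U hU => hk ⟨U, hU⟩ (nbhd_subset (hl ⟨U, hU⟩).le (mem_nbhd _ _) hz),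
    isOpen_nbhd l y, mem_nbhd l y⟩

/-- There are at most `κ` initial segments of branches of a given length. -/
theorem Branches.mk_restrict_le (hreg : κ.IsRegular) (hpow : (2 : Cardinal.{u}) ^< κ = κ)
    (hT : ∀ k, #(range (T.cell k)) ≤ κ) {I : Set κ.ord.ToType} (hI : #I < κ) :
    #(range fun (y : T.Branches) (j : I) => y.1 j) ≤ κ := by
  refine (mk_le_mk_of_subset ?_).trans
    (mk_pi_le hreg hpow hI (fun j => insert ∅ (range (T.cell j.1))) fun j => ?_)
  · rintro _ ⟨y, rfl⟩ j
    exact y.2.1 j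
  · exact mk_insert_le.trans (add_le_of_le hreg.aleph0_le (hT j)
      (one_lt_aleph0.le.trans hreg.aleph0_le))

theorem Branches.mk_basis_le (hreg : κ.IsRegular) (hpow : (2 : Cardinal.{u}) ^< κ = κ)
    (hT : ∀ k, #(range (T.cell k)) ≤ κ) :
    #{U : Set T.Branches | ∃ k y, U = nbhd k y} ≤ κ := by
  refine (mk_le_mk_of_subset (t := ⋃ k, range (nbhd (T := T) k)) ?_).trans
    (mk_iUnion_le_of_le hreg.aleph0_le (mk_ord_toType κ).le _ fun k => ?_)
  · rintro _ ⟨k, y, rfl⟩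
    exact mem_iUnion.2 ⟨k, y, rfl⟩
  · refine (mk_le_mk_of_subset ?_).trans ((mk_image_le (f := fun f : Iic k → Set X =>
      {z : T.Branches | ∀ j : Iic k, z.1 j = f j})).trans
      (mk_restrict_le hreg hpow hT (mk_Iic_lt_self hreg.aleph0_le k)))
    rintro _ ⟨y, rfl⟩
    refine ⟨_, ⟨y, rfl⟩, ?_⟩
    ext z
    simp [nbhd]

variable (T) in
/-- The branch of a point. -/
def branch (x : X) : T.Branches :=
  ⟨fun k => T.cell k x, fun _ => Or.inr ⟨x, rfl⟩, fun _ _ h => T.cell_anti h x,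
    fun k h => absurd (T.mem_cell k x) ((Set.ext_iff.1 h x).not.2 (notMem_empty x))⟩

theorem branch_injective [T1Space X] : Function.Injective T.branch := by
  intro x y h
  by_contra hxy
  obtain ⟨k, hk⟩ := T.exists_cell_ne hxy
  exact hk (congrFun (congrArg Subtype.val h) k)

/-- The intersection of a decreasing sequence of basic sets is given by an initial segment of
a branch. If the cells on it have a common point, then the segment is continued by the cells of
such a point, and by `∅` otherwise. -/
theorem Branches.iInter_nonempty {l : Ordinal.{u}} {V : Ordinal.{u} → Set T.Branches}
    (hV : ∀ i < l, ∃ k y, V i = nbhd k y)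
    (hanti : ∀ i j, i ≤ j → j < l → V j ⊆ V i) : (⋂ i < l, V i).Nonempty := by
  classical
  have hV' (i : Iio l) : ∃ k y, V i = nbhd k y := hV i i.2
  choose k y hky using hV'
  have hle {i i' : Iio l} (h : i ≤ i') {j : κ.ord.ToType} (hj : j ≤ k i) :
      (y i').1 j = (y i).1 j := by
    have := hanti i i' h i'.2
    rw [hky, hky] at this
    exact this (mem_nbhd _ _) j hj
  have hco {i i' : Iio l} {j : κ.ord.ToType} (hj : j ≤ k i) (hj' : j ≤ k i') :
      (y i').1 j = (y i).1 j := by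
    rcases le_total i i' with h | h
    exacts [hle h hj, (hle h hj').symm]
  suffices ∃ z : T.Branches, ∀ i, ∀ j ≤ k i, z.1 j = (y i).1 j by
    obtain ⟨z, hz⟩ := this
    refine ⟨z, mem_iInter₂.2 fun i hi => ?_⟩
    rw [hky ⟨i, hi⟩]
    exact hz ⟨i, hi⟩
  by_cases hne : ∃ x, ∀ i, ∀ j ≤ k i, x ∈ (y i).1 j
  · obtain ⟨x, hx⟩ := hne
    refine ⟨T.branch x, fun i j hj => ?_⟩
    rcases (y i).2.1 j with h | ⟨x', h⟩
    · exact absurd (hx i j hj) ((Set.ext_iff.1 h x).not.2 (notMem_empty x))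
    · have := hx i j hj
      rw [← h] at this ⊢
      exact T.cell_eq_of_mem this
  · let z : κ.ord.ToType → Set X := fun j => if h : ∃ i, j ≤ k i then (y h.choose).1 j else ∅
    have hz {i : Iio l} {j : κ.ord.ToType} (hj : j ≤ k i) : z j = (y i).1 j := by
      have h : ∃ i, j ≤ k i := ⟨i, hj⟩
      simp only [z, dif_pos h]
      exact hco hj h.choose_spec
    have hz0 {j : κ.ord.ToType} (hj : ¬ ∃ i, j ≤ k i) : z j = ∅ := dif_neg hj
    refine ⟨⟨z, fun j => ?_, fun j j' hjj' => ?_, fun j hj => ?_⟩, fun i j hj => hz hj⟩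
    · by_cases h : ∃ i, j ≤ k i
      · obtain ⟨i, hi⟩ := h
        rw [hz hi]
        exact (y i).2.1 j
      · exact Or.inl (hz0 h)
    · by_cases h : ∃ i, j' ≤ k i
      · obtain ⟨i, hi⟩ := h
        rw [hz hi, hz (hjj'.trans hi)]
        exact (y i).2.2.1 j j' hjj'
      · rw [hz0 h]
        exact empty_subset _
    · by_cases h : ∃ i, j ≤ k i
      · obtain ⟨i, hi⟩ := h
        rw [hz hi] at hj
        rw [← (y i).2.2.2 j hj]
        exact iInter₂_congr fun j' hj' => hz (hj'.le.trans hi)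
      · refine eq_empty_of_forall_notMem fun x hx => hne ⟨x, fun i j' hj' => ?_⟩
        have hlt : j' < j := lt_of_not_ge fun hle => h ⟨i, hle.trans hj'⟩
        rw [← hz hj']
        exact mem_iInter₂.1 hx j' hlt

theorem Branches.isAdditiveSC (hreg : κ.IsRegular) (hpow : (2 : Cardinal.{u}) ^< κ = κ)
    (hT : ∀ k, #(range (T.cell k)) ≤ κ) : IsAdditiveSC κ T.Branches :=
  ⟨isAdditive hreg, t3Space hreg, ⟨_, isTopologicalBasis hreg, mk_basis_le hreg hpow hT⟩,
    (isAdditive hreg).exists_isWinning (isTopologicalBasis hreg) fun _ _ _ hV hanti =>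
      iInter_nonempty (fun i hi => (hV i hi).1) hanti⟩

theorem preimage_branch_mem_bor (hB : ∀ k x, T.cell k x ∈ Bor κ X) (k : κ.ord.ToType)
    (y : T.Branches) : T.branch ⁻¹' Branches.nbhd k y ∈ Bor κ X := by
  rcases (T.branch ⁻¹' Branches.nbhd k y).eq_empty_or_nonempty with h | ⟨x, hx⟩
  · rw [h]
    exact bor_of_isOpen isOpen_empty
  · convert hB k x
    ext z
    rw [T.mem_cell_iff]
    exact ⟨fun hz => (hx k le_rfl).trans (hz k le_rfl).symm, fun hz j hj =>
      (T.cell_eq_of_le hj hz).symm.trans (hx j hj)⟩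

theorem image_branch_eq {O : Set X} (hO : IsOpen O) : ∃ U, IsOpen U ∧
    T.branch '' O = range T.branch ∩ U := by
  refine ⟨⋃ p : {p : κ.ord.ToType × X // T.cell p.1 p.2 ⊆ O},
    Branches.nbhd p.1.1 (T.branch p.1.2), isOpen_iUnion fun p => Branches.isOpen_nbhd _ _, ?_⟩
  ext y
  constructor
  · rintro ⟨x, hx, rfl⟩
    obtain ⟨k, hk⟩ := T.exists_cell_subset hO hx
    exact ⟨⟨x, rfl⟩, mem_iUnion.2 ⟨⟨(k, x), hk⟩, Branches.mem_nbhd _ _⟩⟩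
  · rintro ⟨⟨x, rfl⟩, hx⟩
    obtain ⟨⟨⟨k, x'⟩, hk⟩, hx⟩ := mem_iUnion.1 hx
    exact ⟨x, hk (T.mem_cell_iff.2 (hx k le_rfl).symm), rfl⟩

/-- If all branches of length `κ` are branches of points, then the other branches end at a level
below `κ`, and so there are at most `κ` of them. -/
theorem mk_compl_range_branch_le (hreg : κ.IsRegular) (hpow : (2 : Cardinal.{u}) ^< κ = κ)
    (hT : ∀ k, #(range (T.cell k)) ≤ κ) (hc : T.CompleteOn univ) :
    #↥(range T.branch)ᶜ ≤ κ := by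
  refine (mk_le_mk_of_subset (t := ⋃ k, {y : T.Branches | y.1 k = ∅}) fun y hy => ?_).trans
    (mk_iUnion_le_of_le hreg.aleph0_le (mk_ord_toType κ).le _ fun k => ?_)
  · by_contra hne
    simp only [mem_iUnion, not_exists] at hne
    choose b hb using fun k => (y.2.1 k).resolve_left (hne k)
    obtain ⟨z, hz⟩ := hc b fun j _ k _ hjk => by
      refine T.cell_eq_of_mem ?_
      rw [hb j]
      exact y.2.2.1 j k hjk (hb k ▸ T.mem_cell k (b k))
    exact hy ⟨z, Subtype.ext (funext fun k => (hz k (mem_univ k)).trans (hb k))⟩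
  · refine (mk_le_of_injective (f := fun y => (⟨_, y.1, rfl⟩ :
      range fun (y : T.Branches) (j : Iio k) => y.1 j)) ?_).trans
      (Branches.mk_restrict_le hreg hpow hT (mk_Iio_lt_self k))
    intro y z h
    refine Subtype.ext (Subtype.ext (funext fun j => ?_))
    rcases lt_or_ge j k with hj | hj
    · exact congrFun (congrArg Subtype.val h) ⟨j, hj⟩
    · rw [subset_eq_empty (y.1.2.2.1 k j hj) y.2, subset_eq_empty (z.1.2.2.1 k j hj) z.2]

end PartitionTree

/-! ### Borel isomorphisms up to `κ` many points -/

section Iso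

variable {κ : Cardinal.{u}} {X Y : Type u} [TopologicalSpace X] [TopologicalSpace Y]

theorem kBorelIso_of_mk_le [T1Space X] [T1Space Y] (e : X ≃ Y) (hX : #X ≤ κ) : KBorelIso κ X Y :=
  ⟨e, fun _ _ => bor_of_mk_le ((mk_set_le _).trans hX),
    fun _ _ => bor_of_mk_le ((mk_set_le _).trans ((mk_congr e).symm.le.trans hX))⟩

/-- A `κ`-Borel embedding that misses at most `κ` points can be changed at `κ` points to become an
isomorphism, since all sets of size at most `κ` are `κ`-Borel. -/
theorem kBorelIso_of_injective [T1Space X] [T1Space Y] (hκ : ℵ₀ ≤ κ) (hX : κ ≤ #X) {f : X → Y}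
    (hf : f.Injective) (hr : #↥(range f)ᶜ ≤ κ) (h1 : ∀ B ∈ Bor κ Y, f ⁻¹' B ∈ Bor κ X)
    (h2 : ∀ B ∈ Bor κ X, f '' B ∈ Bor κ Y) : KBorelIso κ X Y := by
  classical
  obtain ⟨N, hN⟩ := le_mk_iff_exists_set.1 hX
  have hc : (f '' Nᶜ)ᶜ = (range f)ᶜ ∪ f '' N := by
    rw [← image_univ, ← union_compl_self N, image_union, compl_union, union_comm,
      union_inter_distrib_left, union_compl_self, univ_inter, eq_comm, union_eq_right]
    rintro _ ⟨x, hx, rfl⟩ ⟨x', hx', he⟩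
    exact hx' (hf he ▸ hx)
  have hNN : #↥(f '' Nᶜ)ᶜ = κ := by
    refine le_antisymm ?_ ?_
    · rw [hc]
      exact (mk_union_le _ _).trans (add_le_of_le hκ hr (mk_image_le.trans hN.le))
    · rw [hc]
      calc κ = #(f '' N) := by rw [mk_image_eq hf, hN]
        _ ≤ _ := mk_le_mk_of_subset subset_union_right
  have hNc : #↥(Nᶜ)ᶜ = #↥(f '' Nᶜ)ᶜ := by rw [hNN, compl_compl, hN]
  obtain ⟨e₀⟩ := Cardinal.eq.1 hNc
  let e : X ≃ Y := (Equiv.Set.sumCompl Nᶜ).symm.trans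
    ((Equiv.sumCongr (Equiv.Set.image f Nᶜ hf) e₀).trans (Equiv.Set.sumCompl (f '' Nᶜ)))
  have he (x : X) (hx : x ∈ Nᶜ) : e x = f x := by
    simp only [e, Equiv.trans_apply, Equiv.Set.sumCompl_symm_apply_of_mem hx]
    simp
  have hNb : N ∈ Bor κ X := bor_of_mk_le hN.le
  refine ⟨e, fun B hB => ?_, fun B hB => ?_⟩
  · have : e ⁻¹' B = (f ⁻¹' B ∩ Nᶜ) ∪ (e ⁻¹' B ∩ N) := by
      ext x
      by_cases hx : x ∈ N
      · simp [hx]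
      · simp [hx, he x hx]
    rw [this]
    exact bor_union hκ (bor_inter hκ (h1 B hB) (bor_compl hNb))
      (bor_of_mk_le ((mk_le_mk_of_subset inter_subset_right).trans hN.le))
  · have : e.symm ⁻¹' B = f '' (B ∩ Nᶜ) ∪ e '' (B ∩ N) := by
      rw [← Equiv.image_eq_preimage_symm, ← image_congr fun x hx => he x hx.2, ← image_union,
        ← inter_union_distrib_left, compl_union_self, inter_univ]
    rw [this]
    exact bor_union hκ (h2 _ (bor_inter hκ hB (bor_compl hNb)))
      (bor_of_mk_le (mk_image_le.trans ((mk_le_mk_of_subset inter_subset_right).trans hN.le)))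

theorem isAdditiveSC_of_discreteTopology [DiscreteTopology X] (hX : #X ≤ κ) :
    IsAdditiveSC κ X := by
  have hadd : IsAdditive κ X := fun _ _ _ => isOpen_discrete _
  have hb := isTopologicalBasis_singletons X
  refine ⟨hadd, inferInstance, ⟨_, hb, ?_⟩, hadd.exists_isWinning hb fun l hl V hV hanti => ?_⟩
  · have : {s | ∃ x : X, (s : Set X) = {x}} = range singleton := by
      ext s
      simp [eq_comm]
    rw [this]
    exact mk_range_le.trans hX
  · obtain ⟨x, hx⟩ := (hV 0 hl).1
    refine ⟨x, mem_iInter₂.2 fun i hi => ?_⟩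
    obtain ⟨y, hy⟩ := (hV i hi).2
    obtain rfl : y = x := by simpa [hx] using hanti 0 i zero_le hi hy
    exact hy

theorem IsFSC.exists_isAdditiveSC (hreg : κ.IsRegular) (hunc : ℵ₀ < κ)
    (hpow : (2 : Cardinal.{u}) ^< κ = κ) (hX : IsFSC κ X) :
    ∃ (Y : Type u) (_ : TopologicalSpace Y), IsAdditiveSC κ Y ∧ KBorelIso κ X Y := by
  have hT3 : T3Space X := hX.1
  rcases le_total κ #X with hκ | hκ
  · obtain ⟨T, hB, hT, hc⟩ := hX.exists_partitionTree hreg hunc hpow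
    have hT3' := PartitionTree.Branches.t3Space (T := T) hreg
    have hr := PartitionTree.mk_compl_range_branch_le hreg hpow hT hc
    have hrb : range T.branch ∈ Bor κ T.Branches := compl_compl (range T.branch) ▸
      bor_compl (bor_of_mk_le hr)
    refine ⟨T.Branches, inferInstance, PartitionTree.Branches.isAdditiveSC hreg hpow hT,
      kBorelIso_of_injective hunc.le hκ PartitionTree.branch_injective hr (fun B hBo => ?_)
        fun B hBo => ?_⟩
    · refine preimage_mem_bor (PartitionTree.Branches.isTopologicalBasis hreg)
        (PartitionTree.Branches.mk_basis_le hreg hpow hT) ?_ hBo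
      rintro _ ⟨k, y, rfl⟩
      exact PartitionTree.preimage_branch_mem_bor hB k y
    · refine image_mem_bor hunc.le PartitionTree.branch_injective hrb (fun O hO => ?_) hBo
      obtain ⟨U, hU, he⟩ := PartitionTree.image_branch_eq (T := T) hO
      rw [he]
      exact bor_inter hunc.le hrb (bor_of_isOpen hU)
  · -- a space of size at most `κ` may as well be discrete
    obtain ⟨Z, t, hZ, ⟨e⟩⟩ : ∃ (Z : Type u) (t : TopologicalSpace Z), DiscreteTopology Z ∧
        Nonempty (X ≃ Z) := ⟨X, ⊥, @DiscreteTopology.mk X ⊥ rfl, ⟨Equiv.refl X⟩⟩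
    exact ⟨Z, t, isAdditiveSC_of_discreteTopology ((mk_congr e).symm.le.trans hκ),
      kBorelIso_of_mk_le e hκ⟩

end Iso

theorem IsSC.isFSC {κ : Cardinal.{u}} (hreg : κ.IsRegular) {X : Type u} [TopologicalSpace X]
    (hX : IsSC κ X) : IsFSC κ X := by
  obtain ⟨hT, hw, σ, hσ⟩ := hX
  refine ⟨hT, hw, σ, fun p γ hγ hp => ⟨(hσ p γ hγ hp).1, fun h => (hσ p γ hγ hp).2 ?_⟩⟩
  exact h ▸ isSuccLimit_ord hreg.aleph0_le

/-- Two classes that contain `A` and are contained in `F` are the same up to isomorphism, if each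
space in `F` is isomorphic to one in `A`. -/
theorem sameUpToKBorelIso_of_le {κ : Cardinal.{u}} {A C D F : SpaceClass.{u}}
    (hAC : ∀ (X : Type u) [TopologicalSpace X], A X → C X)
    (hAD : ∀ (X : Type u) [TopologicalSpace X], A X → D X)
    (hCF : ∀ (X : Type u) [TopologicalSpace X], C X → F X)
    (hDF : ∀ (X : Type u) [TopologicalSpace X], D X → F X)
    (hFA : ∀ (X : Type u) [TopologicalSpace X], F X →
      ∃ (Y : Type u) (_ : TopologicalSpace Y), A Y ∧ KBorelIso κ X Y) :
    SameUpToKBorelIso κ C D := by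
  refine ⟨fun X _ hX => ?_, fun X _ hX => ?_⟩
  · obtain ⟨Y, t, hY, hXY⟩ := hFA X (hCF X hX)
    exact ⟨Y, t, hAD Y hY, hXY⟩
  · obtain ⟨Y, t, hY, hXY⟩ := hFA X (hDF X hX)
    exact ⟨Y, t, hAC Y hY, hXY.symm⟩

end GenPolish

theorem mainTheorem3 (κ : Cardinal.{u}) (hreg : κ.IsRegular) (hunc : ℵ₀ < κ)
    (hpow : (2 : Cardinal.{u}) ^< κ = κ) :
    -- the classes that do not involve a group
    (GenPolish.SameUpToKBorelIso κ (fun X _ => GenPolish.IsFSC κ X)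
        (fun X _ => GenPolish.IsSC κ X) ∧
      GenPolish.SameUpToKBorelIso κ (fun X _ => GenPolish.IsFSC κ X)
        (fun X _ => GenPolish.IsAdditiveSC κ X) ∧
      GenPolish.SameUpToKBorelIso κ (fun X _ => GenPolish.IsSC κ X)
        (fun X _ => GenPolish.IsAdditiveSC κ X)) ∧
    -- the classes that involve a totally ordered abelian group of degree `κ`
    ∀ (G : Type u) [AddCommGroup G] [LinearOrder G] [IsOrderedAddMonoid G],
      GenPolish.degree G = κ →
      GenPolish.SameUpToKBorelIso κ (fun X _ => GenPolish.IsFSC κ X)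
        (fun X _ => GenPolish.IsGPolish κ G X) ∧
      GenPolish.SameUpToKBorelIso κ (fun X _ => GenPolish.IsSC κ X)
        (fun X _ => GenPolish.IsGPolish κ G X) ∧
      GenPolish.SameUpToKBorelIso κ (fun X _ => GenPolish.IsGPolish κ G X)
        (fun X _ => GenPolish.IsAdditiveSC κ X) ∧
      ∀ (X : Type u) [TopologicalSpace X],
        GenPolish.IsAdditiveSC κ X ↔ GenPolish.IsSphericallyCompleteGPolish κ G X := by
  have hFA : ∀ (X : Type u) [TopologicalSpace X], GenPolish.IsFSC κ X →
      ∃ (Y : Type u) (_ : TopologicalSpace Y), GenPolish.IsAdditiveSC κ Y ∧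
        GenPolish.KBorelIso κ X Y := fun X _ hX => hX.exists_isAdditiveSC hreg hunc hpow
  have hSF : ∀ (X : Type u) [TopologicalSpace X], GenPolish.IsSC κ X → GenPolish.IsFSC κ X :=
    fun X _ hX => hX.isFSC hreg
  have hAF : ∀ (X : Type u) [TopologicalSpace X], GenPolish.IsAdditiveSC κ X →
      GenPolish.IsFSC κ X := fun X _ hX => hSF X hX.2
  have hAS : ∀ (X : Type u) [TopologicalSpace X], GenPolish.IsAdditiveSC κ X →
      GenPolish.IsSC κ X := fun X _ hX => hX.2
  refine ⟨⟨?_, ?_, ?_⟩, fun G _ _ _ hG => ?_⟩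
  · exact GenPolish.sameUpToKBorelIso_of_le hAF hAS (fun _ _ h => h) hSF hFA
  · exact GenPolish.sameUpToKBorelIso_of_le hAF (fun _ _ h => h) (fun _ _ h => h) hAF hFA
  · exact GenPolish.sameUpToKBorelIso_of_le hAS (fun _ _ h => h) hSF hAF hFA
  · have hAG : ∀ (X : Type u) [TopologicalSpace X], GenPolish.IsAdditiveSC κ X →
        GenPolish.IsGPolish κ G X :=
      fun X _ hX => (hX.isSphericallyCompleteGPolish hreg hunc hG).isGPolish
    have hGF : ∀ (X : Type u) [TopologicalSpace X], GenPolish.IsGPolish κ G X →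
        GenPolish.IsFSC κ X := fun X _ hX => hX.isFSC hreg hunc hG
    exact ⟨GenPolish.sameUpToKBorelIso_of_le hAF hAG (fun _ _ h => h) hGF hFA,
      GenPolish.sameUpToKBorelIso_of_le hAS hAG hSF hGF hFA,
      GenPolish.sameUpToKBorelIso_of_le hAG (fun _ _ h => h) hGF hAF hFA,
      fun X _ => ⟨fun hX => hX.isSphericallyCompleteGPolish hreg hunc hG,
        fun hX => hX.isAdditiveSC hreg hG⟩⟩
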